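/- For an integer $n\ge 2$, a positive integer $q$ and integers $s_1,\dots,s_n$ with $\gcd(q,s_j)=1$ for all $1\le j\le n$, let $\gamma\in \mathrm{SO}(2n)$ be the block-diagonal matrix with the $2\times 2$ blocks $$\begin{pmatrix}\cos(2\pi s_j/q) & \sin(2\pi s_j/q)\\ -\sin(2\pi s_j/q) & \cos(2\pi s_j/q)\end{pmatrix},\qquad j=1,\dots,n,$$ and let $L(q;s_1,\dots,s_n)=\langle\gamma\rangle\backslash S^{2n-1}$ be the corresponding lens space, with the Riemannian metric induced by the round metric of the unit sphere $S^{2n-1}\subset\mathbb R^{2n}$. Its associated congruence lattice is $$\mathcal L(q;s_1,\dots,s_n)=\{(a_1,\dots,a_n)\in\mathbb Z^n : a_1s_1+\dots+a_ns_n\equiv 0 \pmod q\}.$$ For such a lattice $\mathcal L$ and an integer $k\ge 0$, let $N_{\mathcal L}(k)$ be the number of $(a_1,\dots,a_n)\in\mathcal L$ with $|a_1|+\dots+|a_n|=k$, and let $\vartheta_{\mathcal L}(z)=\sum_{k\ge 0}N_{\mathcal L}(k)\,z^k$, as a formal power series, be its one-norm theta function. Theorem. Let $L=L(q;s_1,\dots,s_n)$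 and $L'=L(q';s_1',\dots,s_{n'}')$ be two lens spaces, and let $\mathcal L$ and $\mathcal L'$ be their associated congruence lattices. Then $L$ and $L'$ are isospectral (that is, their Laplace–Beltrami operators on smooth complex-valued functions have the same eigenvalues with the same multiplicities) if and only if $\mathcal L$ and $\mathcal L'$ are one-norm isospectral, that is, $\vartheta_{\mathcal L}(z)=\vartheta_{\mathcal L'}(z)$. -/

import Mathlib

open scoped Manifold ContDiff PowerSeries

noncomputable section

namespace LensSpectra

/-! ### The Laplace–Beltrami operator of the round unit sphere, in local coordinates -/

/-- The partial derivative `∂_i h` of a function on `ℝ^m`. -/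
def pderiv {m : ℕ} {F : Type*} [NormedAddCommGroup F] [NormedSpace ℝ F] (i : Fin m)
    (h : EuclideanSpace ℝ (Fin m) → F) (u : EuclideanSpace ℝ (Fin m)) : F :=
  fderiv ℝ h u (EuclideanSpace.single i 1)

section Sphere

variable {E : Type*} [NormedAddCommGroup E] [InnerProductSpace ℝ E] {m : ℕ}
  [Fact (Module.finrank ℝ E = m + 1)]

/-- The local parametrization of the unit sphere of `E` around `x`: the inverse of Mathlib's
chart at `x`. -/
def param (x : Metric.sphere (0 : E) 1) (u : EuclideanSpace ℝ (Fin m)) :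
    Metric.sphere (0 : E) 1 :=
  (chartAt (EuclideanSpace ℝ (Fin m)) x).symm u

/-- The matrix `(g_ij(u))` of the Riemannian metric that the sphere inherits from `E`, in the
chart at `x`, at the point of the sphere with coordinates `u`. -/
def metricCoeff (x : Metric.sphere (0 : E) 1) (u : EuclideanSpace ℝ (Fin m)) :
    Matrix (Fin m) (Fin m) ℝ :=
  Matrix.of fun i j =>
    inner ℝ (pderiv i (fun w => (param x w : E)) u) (pderiv j (fun w => (param x w : E)) u)

/-- The Christoffel symbol
`Γ^k_ij = 1/2 ∑_l g^{kl} (∂_i g_jl + ∂_j g_il - ∂_l g_ij)` of that metric, in the chart at `x`. -/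
def christoffel (x : Metric.sphere (0 : E) 1) (k i j : Fin m)
    (u : EuclideanSpace ℝ (Fin m)) : ℝ :=
  (1 / 2 : ℝ) * ∑ l, (metricCoeff x u)⁻¹ k l *
    (pderiv i (fun w => metricCoeff x w j l) u + pderiv j (fun w => metricCoeff x w i l) u
      - pderiv l (fun w => metricCoeff x w i j) u)

/-- The (non-negative) Laplace–Beltrami operator of the unit sphere of `E` on functions: minus
the trace of the covariant Hessian,
`Δ f = - ∑_{i,j} g^{ij} (∂_i ∂_j f - ∑_k Γ^k_ij ∂_k f)`,
evaluated at `x` in the coordinates of the chart at `x`. -/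
def laplaceBeltrami (m : ℕ) [Fact (Module.finrank ℝ E = m + 1)]
    (f : Metric.sphere (0 : E) 1 → ℂ) (x : Metric.sphere (0 : E) 1) : ℂ :=
  let u : EuclideanSpace ℝ (Fin m) := chartAt (EuclideanSpace ℝ (Fin m)) x x
  let F : EuclideanSpace ℝ (Fin m) → ℂ := fun w => f (param x w);
  - ∑ i, ∑ j, (((metricCoeff x u)⁻¹ i j : ℝ) : ℂ) *
      (pderiv i (pderiv j F) u - ∑ k, ((christoffel x k i j u : ℝ) : ℂ) * pderiv k F u)

end Sphere

/-! ### Lens spaces -/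

/-- The parameters `(q; s_1, …, s_n)` of a lens space `L(q; s_1, …, s_n)` of dimension `2n - 1`,
`n ≥ 2`: `q` is a positive integer and every `s_j` is an integer coprime to `q`. -/
structure LensParams where
  n : ℕ
  q : ℕ
  s : Fin n → ℤ
  two_le_n : 2 ≤ n
  q_pos : 0 < q
  coprime : ∀ j, IsCoprime (q : ℤ) (s j)

namespace LensParams

/-- The space `ℝ^{2n}` with its Euclidean norm; the coordinate with index `(i, j)` is the
`i`-th coordinate of the `j`-th of `n` planes. -/
abbrev Ambient (P : LensParams) : Type := EuclideanSpace ℝ (Fin 2 × Fin P.n)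

/-- The unit sphere `S^{2n-1}`. -/
abbrev Sphere (P : LensParams) : Type := Metric.sphere (0 : P.Ambient) 1

instance (P : LensParams) : Fact (Module.finrank ℝ P.Ambient = (2 * P.n - 1) + 1) :=
  ⟨by
    have := P.two_le_n
    simp only [finrank_euclideanSpace, Fintype.card_prod, Fintype.card_fin]
    omega⟩

end LensParams

/-- The orthogonal group acts on the unit sphere by multiplication of column vectors. -/
instance orthogonalGroupAction (ι : Type*) [Fintype ι] [DecidableEq ι] :
    MulAction (Matrix.orthogonalGroup ι ℝ) (Metric.sphere (0 : EuclideanSpace ℝ ι) 1) where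
  smul A x := ⟨WithLp.toLp 2 ((A : Matrix ι ι ℝ).mulVec x.1.ofLp), by
    have hx : x.1.ofLp ⬝ᵥ x.1.ofLp = 1 := by
      have h1 : ‖x.1‖ = 1 := by simp
      have h2 := EuclideanSpace.real_norm_sq_eq x.1
      rw [h1, one_pow] at h2
      simp only [dotProduct]
      refine Eq.trans ?_ h2.symm
      exact Finset.sum_congr rfl fun i _ => by ring
    have hA : (A : Matrix ι ι ℝ).transpose * (A : Matrix ι ι ℝ) = 1 :=
      (Matrix.mem_orthogonalGroup_iff' ι ℝ).1 A.2
    rw [mem_sphere_zero_iff_norm, ← sq_eq_sq₀ (norm_nonneg _) zero_le_one, one_pow,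
      EuclideanSpace.real_norm_sq_eq]
    have h3 : (A : Matrix ι ι ℝ).mulVec x.1.ofLp ⬝ᵥ (A : Matrix ι ι ℝ).mulVec x.1.ofLp = 1 := by
      rw [Matrix.dotProduct_mulVec, Matrix.vecMul_mulVec, ← Matrix.dotProduct_mulVec, hA,
        Matrix.one_mulVec, hx]
    refine Eq.trans ?_ h3
    simp only [dotProduct]
    exact Finset.sum_congr rfl fun i _ => by ring⟩
  one_smul x := by
    apply Subtype.ext
    change WithLp.toLp 2 ((1 : Matrix ι ι ℝ).mulVec x.1.ofLp) = x.1
    rw [Matrix.one_mulVec]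
  mul_smul A B x := by
    apply Subtype.ext
    change WithLp.toLp 2 (((A : Matrix ι ι ℝ) * (B : Matrix ι ι ℝ)).mulVec x.1.ofLp) =
      WithLp.toLp 2 ((A : Matrix ι ι ℝ).mulVec ((B : Matrix ι ι ℝ).mulVec x.1.ofLp))
    rw [Matrix.mulVec_mulVec]

namespace LensParams

/-- The block-diagonal matrix with the `2 × 2` blocks
`[cos(2πs_j/q), sin(2πs_j/q); -sin(2πs_j/q), cos(2πs_j/q)]`, `j = 1, …, n`. -/
def gammaMatrix (P : LensParams) : Matrix (Fin 2 × Fin P.n) (Fin 2 × Fin P.n) ℝ :=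
  Matrix.blockDiagonal fun j =>
    !![Real.cos (2 * Real.pi * P.s j / P.q), Real.sin (2 * Real.pi * P.s j / P.q);
      -Real.sin (2 * Real.pi * P.s j / P.q), Real.cos (2 * Real.pi * P.s j / P.q)]

theorem gammaMatrix_mem (P : LensParams) :
    P.gammaMatrix ∈ Matrix.orthogonalGroup (Fin 2 × Fin P.n) ℝ := by
  rw [Matrix.mem_orthogonalGroup_iff, gammaMatrix, Matrix.blockDiagonal_transpose,
    ← Matrix.blockDiagonal_mul, ← Matrix.blockDiagonal_one]
  congr 1
  funext j
  ext a b
  have h := Real.sin_sq_add_cos_sq (2 * Real.pi * P.s j / P.q)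
  fin_cases a <;> fin_cases b <;> simp [Matrix.mul_apply, Fin.sum_univ_two] <;> nlinarith [h]

/-- The isometry `γ` of `S^{2n-1}` that defines the lens space. -/
def gamma (P : LensParams) : Matrix.orthogonalGroup (Fin 2 × Fin P.n) ℝ :=
  ⟨P.gammaMatrix, P.gammaMatrix_mem⟩

/-- The lens space `L(q; s_1, …, s_n) = ⟨γ⟩ \ S^{2n-1}`. -/
abbrev LensSpace (P : LensParams) : Type :=
  MulAction.orbitRel.Quotient (Subgroup.zpowers P.gamma) P.Sphere

/-- The projection `S^{2n-1} → L(q; s_1, …, s_n)`. -/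
def proj (P : LensParams) (x : P.Sphere) : P.LensSpace := Quotient.mk _ x

/-- A complex function on the lens space is smooth if its lift to the sphere is. (The projection
is a surjective local diffeomorphism for the smooth structure of the lens space.) -/
def IsSmooth (P : LensParams) (f : P.LensSpace → ℂ) : Prop :=
  ContMDiff (𝓡 (2 * P.n - 1)) 𝓘(ℝ, ℂ) ∞ (fun x : P.Sphere => f (P.proj x))

/-- `h = Δ f` for the Laplace–Beltrami operator `Δ` of the lens space. The Riemannian metric of
the lens space is the one for which the projection is a local isometry, so that `Δ` is
determined by `(Δ f) ∘ proj = Δ_{S^{2n-1}} (f ∘ proj)`. -/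
def IsLaplacian (P : LensParams) (f h : P.LensSpace → ℂ) : Prop :=
  ∀ x : P.Sphere, h (P.proj x) = laplaceBeltrami (2 * P.n - 1) (fun y => f (P.proj y)) x

end LensParams

section Linearity

variable {E : Type*} [NormedAddCommGroup E] [InnerProductSpace ℝ E] {m : ℕ}
  [Fact (Module.finrank ℝ E = m + 1)]

theorem contDiff_comp_param {f : Metric.sphere (0 : E) 1 → ℂ}
    (hf : ContMDiff (𝓡 m) 𝓘(ℝ, ℂ) ∞ f) (x : Metric.sphere (0 : E) 1) :
    ContDiff ℝ ∞ (fun u : EuclideanSpace ℝ (Fin m) => f (param x u)) := by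
  have h1 : ContMDiffOn (𝓡 m) (𝓡 m) ∞ (chartAt (EuclideanSpace ℝ (Fin m)) x).symm
      (chartAt (EuclideanSpace ℝ (Fin m)) x).target := contMDiffOn_chart_symm
  have ht : (chartAt (EuclideanSpace ℝ (Fin m)) x).target = Set.univ :=
    stereographic'_target (-x)
  rw [ht, contMDiffOn_univ] at h1
  exact (hf.comp h1).contDiff

theorem contDiff_pderiv {F : EuclideanSpace ℝ (Fin m) → ℂ} (hF : ContDiff ℝ ∞ F)
    (i : Fin m) : ContDiff ℝ ∞ (pderiv i F) :=
  (hF.fderiv_right (m := ∞) (by simp)).clm_apply contDiff_const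

theorem pderiv_add {F G : EuclideanSpace ℝ (Fin m) → ℂ} (hF : ContDiff ℝ ∞ F)
    (hG : ContDiff ℝ ∞ G) (i : Fin m) :
    pderiv i (fun u => F u + G u) = fun u => pderiv i F u + pderiv i G u := by
  funext u
  simp only [pderiv]
  rw [fderiv_fun_add (hF.differentiable (by simp) u) (hG.differentiable (by simp) u)]
  rfl

theorem pderiv_const_mul {F : EuclideanSpace ℝ (Fin m) → ℂ} (hF : ContDiff ℝ ∞ F) (c : ℂ)
    (i : Fin m) : pderiv i (fun u => c * F u) = fun u => c * pderiv i F u := by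
  funext u
  simp only [pderiv]
  rw [fderiv_const_mul (hF.differentiable (by simp) u)]
  rfl

theorem laplaceBeltrami_add {f g : Metric.sphere (0 : E) 1 → ℂ}
    (hf : ContMDiff (𝓡 m) 𝓘(ℝ, ℂ) ∞ f) (hg : ContMDiff (𝓡 m) 𝓘(ℝ, ℂ) ∞ g)
    (x : Metric.sphere (0 : E) 1) :
    laplaceBeltrami m (fun y => f y + g y) x = laplaceBeltrami m f x + laplaceBeltrami m g x := by
  have hF := contDiff_comp_param hf x
  have hG := contDiff_comp_param hg x
  simp only [laplaceBeltrami, pderiv_add hF hG,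
    pderiv_add (contDiff_pderiv hF _) (contDiff_pderiv hG _)]
  rw [← neg_add, ← Finset.sum_add_distrib]
  congr 1
  refine Finset.sum_congr rfl fun i _ => ?_
  rw [← Finset.sum_add_distrib]
  refine Finset.sum_congr rfl fun j _ => ?_
  simp only [mul_add, Finset.sum_add_distrib]
  ring

theorem laplaceBeltrami_const_mul {f : Metric.sphere (0 : E) 1 → ℂ}
    (hf : ContMDiff (𝓡 m) 𝓘(ℝ, ℂ) ∞ f) (c : ℂ) (x : Metric.sphere (0 : E) 1) :
    laplaceBeltrami m (fun y => c * f y) x = c * laplaceBeltrami m f x := by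
  have hF := contDiff_comp_param hf x
  simp only [laplaceBeltrami, pderiv_const_mul hF, pderiv_const_mul (contDiff_pderiv hF _)]
  rw [mul_neg, Finset.mul_sum]
  congr 1
  refine Finset.sum_congr rfl fun i _ => ?_
  rw [Finset.mul_sum]
  refine Finset.sum_congr rfl fun j _ => ?_
  have : ∀ k, ((christoffel x k i j (chartAt (EuclideanSpace ℝ (Fin m)) x x) : ℝ) : ℂ) *
      (c * pderiv k (fun u => f (param x u)) (chartAt (EuclideanSpace ℝ (Fin m)) x x)) =
      c * (((christoffel x k i j (chartAt (EuclideanSpace ℝ (Fin m)) x x) : ℝ) : ℂ) *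
      pderiv k (fun u => f (param x u)) (chartAt (EuclideanSpace ℝ (Fin m)) x x)) :=
    fun k => by ring
  simp only [this, ← Finset.mul_sum]
  ring

end Linearity

namespace LensParams

/-- The eigenspace `{f ∈ C^∞(L, ℂ) : Δ f = μ f}` of the Laplace–Beltrami operator of the lens
space `L`. -/
def eigenspace (P : LensParams) (μ : ℂ) : Submodule ℂ (P.LensSpace → ℂ) where
  carrier := {f | P.IsSmooth f ∧ P.IsLaplacian f (fun p => μ * f p)}
  add_mem' := by
    rintro f g ⟨hf, hf'⟩ ⟨hg, hg'⟩
    refine ⟨hf.add hg, fun x => ?_⟩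
    have h := laplaceBeltrami_add hf hg x
    simp only [Pi.add_apply]
    rw [h, ← hf' x, ← hg' x, mul_add]
  zero_mem' := by
    refine ⟨contMDiff_const, fun x => ?_⟩
    have h := laplaceBeltrami_const_mul (E := P.Ambient) (m := 2 * P.n - 1)
      (f := fun _ => 0) contMDiff_const 0 x
    simpa using h.symm
  smul_mem' := by
    rintro c f ⟨hf, hf'⟩
    refine ⟨(contDiff_const_smul (n := ∞) (𝕜 := ℝ) (F := ℂ) c).contMDiff.comp hf, fun x => ?_⟩
    have h := laplaceBeltrami_const_mul hf c x
    simp only [Pi.smul_apply, smul_eq_mul]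
    rw [h, ← hf' x]
    ring

/-- Two lens spaces are isospectral (on functions) if their Laplace–Beltrami operators have the
same eigenvalues with the same multiplicities. -/
def Isospectral (P P' : LensParams) : Prop :=
  ∀ μ : ℂ, Module.rank ℂ (P.eigenspace μ) = Module.rank ℂ (P'.eigenspace μ)

/-! ### Congruence lattices -/

/-- The congruence lattice `{a ∈ ℤ^n : a_1 s_1 + ⋯ + a_n s_n ≡ 0 (mod q)}`. -/
def congruenceLattice (P : LensParams) : AddSubgroup (Fin P.n → ℤ) where
  carrier := {a | ∑ j, a j * P.s j ≡ 0 [ZMOD P.q]}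
  add_mem' := by
    intro a b ha hb
    simp only [Set.mem_ofPred_eq, Pi.add_apply, add_mul, Finset.sum_add_distrib] at *
    simpa using ha.add hb
  zero_mem' := by
    simp only [Set.mem_ofPred_eq, Pi.zero_apply, zero_mul, Finset.sum_const_zero]
    exact Int.ModEq.refl 0
  neg_mem' := by
    intro a ha
    simp only [Set.mem_ofPred_eq, Pi.neg_apply, neg_mul, Finset.sum_neg_distrib] at *
    simpa using ha.neg

end LensParams

/-- The one-norm `|a_1| + ⋯ + |a_n|` on `ℤ^n`. -/
def oneNorm {n : ℕ} (a : Fin n → ℤ) : ℕ := ∑ j, (a j).natAbs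

theorem finite_oneNorm_eq {n : ℕ} (k : ℕ) : {a : Fin n → ℤ | oneNorm a = k}.Finite := by
  refine (Set.Finite.pi' fun _ : Fin n => Set.finite_Icc (-(k : ℤ)) k).subset fun a ha j => ?_
  have h : (a j).natAbs ≤ oneNorm a :=
    Finset.single_le_sum (f := fun j => (a j).natAbs) (fun _ _ => Nat.zero_le _)
      (Finset.mem_univ j)
  rw [Set.mem_ofPred_eq] at ha
  rw [Set.mem_Icc]
  omega

namespace LensParams

/-- The number `N(k)` of elements of the congruence lattice with one-norm `k` (a finite number, by
`finite_oneNorm_eq`). -/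
def latticeCount (P : LensParams) (k : ℕ) : ℕ :=
  Set.ncard {a : Fin P.n → ℤ | a ∈ P.congruenceLattice ∧ oneNorm a = k}

/-- The one-norm theta function `∑_{k ≥ 0} N(k) z^k` of the congruence lattice, as a formal power
series. -/
def theta (P : LensParams) : ℤ⟦X⟧ := PowerSeries.mk fun k => (P.latticeCount k : ℤ)

end LensParams

end LensSpectra

end

/-! In the coordinates z_j and conj z_j the isometry γ is diagonal, so the γ-invariant polynomials
are spanned by the invariant monomials, and a monomial with exponents (e_0j, e_1j) is invariant
exactly when the vector of differences a_j = e_0j - e_1j lies in the congruence lattice. Recording a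
together with the minima m_j = min(e_0j, e_1j) loses nothing, and the degree is |a|_1 + 2 ∑ m_j.
Hence the space of invariant homogeneous polynomials of degree k has dimension d_k = ∑_r N(k - 2r)
M(n, r), where M(n, r) counts monomials of degree r in n variables (`ncard_expSet_eq_sum`).

The only possible eigenvalues are λ_k = k(k + 2n - 2), and λ_k has multiplicity d_k - d_{k-2}, with
d_{-1} = d_{-2} = 0 (`rank_eigenspace_eq_zero`, `finrank_eigenspace_add`). The lower bound comes
from invariant harmonic polynomials: they form the kernel of a map from dimension d_k to dimension
d_{k-2}, and they restrict injectively to the sphere. For the upper bound, symmetry of the Laplacian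
gives (μ - λ_k)⟨f, p⟩ = -4⟨f, ∑ ∂_j conj∂_j p⟩ for an eigenfunction f and p homogeneous of degree k.
By descent in the degree and Stone-Weierstrass, f in the λ_k-eigenspace is determined by its pairing
with degree k, and that pairing kills |z|² times degree k - 2. The two bounds meet, so neither
surjectivity of the Laplacian on polynomials nor the harmonic decomposition is needed.

For equal n, the multiplicities, the d_k and the N(k) determine one another by triangular
recursions. That n agrees is part of the claim on both sides. From the spectrum: every λ_{2r}
occurs, and these numbers cannot all be of the form j(j + 2n' - 2) when n < n'
(`le_of_isospectral`). From theta: the partial sums of N grow like the n-th power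
(`n_le_of_latticeCount_eq`). -/

noncomputable section

namespace LensSpectra

/-! ### Second derivatives along curves and Euler's identities. -/

section SecondDerivatives

variable {E : Type*} [NormedAddCommGroup E] [NormedSpace ℝ E]

theorem deriv_deriv_comp {G : E → ℂ} {c c' : ℝ → E} {c'' : E} {t : ℝ}
    (hG : ContDiffAt ℝ 2 G (c t)) (hc : ∀ᶠ s in nhds t, HasDerivAt c (c' s) s)
    (hc' : HasDerivAt c' c'' t) :
    deriv (deriv fun s => G (c s)) t =
      fderiv ℝ (fderiv ℝ G) (c t) (c' t) (c' t) + fderiv ℝ G (c t) c'' := by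
  have hct : ContinuousAt c t := hc.self_of_nhds.continuousAt
  have h1 : ∀ᶠ y in nhds (c t), DifferentiableAt ℝ G y :=
    (hG.eventually (by simp)).mono fun y hy => hy.differentiableAt (by simp)
  have h2 : deriv (fun s => G (c s)) =ᶠ[nhds t] fun s => fderiv ℝ G (c s) (c' s) := by
    filter_upwards [hct.eventually h1, hc] with s hs hs'
    exact (hs.hasFDerivAt.comp_hasDerivAt s hs').deriv
  rw [h2.deriv_eq]
  have h3 : DifferentiableAt ℝ (fderiv ℝ G) (c t) :=
    (hG.fderiv_right (m := 1) (by norm_num)).differentiableAt (by simp)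
  have h4 : HasDerivAt (fun s => fderiv ℝ G (c s)) (fderiv ℝ (fderiv ℝ G) (c t) (c' t)) t :=
    h3.hasFDerivAt.comp_hasDerivAt t hc.self_of_nhds
  exact (h4.clm_apply hc').deriv

/-- Euler's identity for a function that is homogeneous of degree `k` on a ray. -/
theorem fderiv_apply_self_of_homogeneous {G : E → ℂ} {x : E} {k : ℕ}
    (hG : DifferentiableAt ℝ G x) (hk : ∀ t : ℝ, 0 < t → G (t • x) = (t : ℂ) ^ k * G x) :
    fderiv ℝ G x x = k * G x := by
  have h1 : HasDerivAt (fun t : ℝ => G (t • x)) (fderiv ℝ G x x) 1 := by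
    have hc : HasDerivAt (fun t : ℝ => t • x) x 1 := by
      simpa using (hasDerivAt_id (1 : ℝ)).smul_const x
    have hG' : HasFDerivAt G (fderiv ℝ G x) ((1 : ℝ) • x) := by
      simpa using hG.hasFDerivAt
    exact hG'.comp_hasDerivAt 1 hc
  have h2 : HasDerivAt (fun t : ℝ => (t : ℂ) ^ k * G x) (k * G x) 1 := by
    have := ((Complex.ofRealCLM.hasDerivAt (x := (1 : ℝ))).pow k).mul_const (G x)
    simpa using this
  refine h1.unique (h2.congr_of_eventuallyEq ?_)
  filter_upwards [lt_mem_nhds (zero_lt_one (α := ℝ))] with t ht using hk t ht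

theorem fderiv_fderiv_apply_self_of_homogeneous {G : E → ℂ} {x : E} {k : ℕ}
    (hG : ContDiffAt ℝ 2 G x) (hk : ∀ t : ℝ, 0 < t → G (t • x) = (t : ℂ) ^ k * G x) :
    fderiv ℝ (fderiv ℝ G) x x x = k * (k - 1) * G x := by
  have h1 := deriv_deriv_comp (G := G) (c := fun t : ℝ => t • x) (c' := fun _ => x) (c'' := 0)
    (t := 1) (by simpa using hG)
    (Filter.Eventually.of_forall fun s => by simpa using (hasDerivAt_id s).smul_const x)
    (hasDerivAt_const _ _)
  simp only [one_smul, map_zero, add_zero] at h1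
  rw [← h1]
  have h2 : (fun t : ℝ => G (t • x)) =ᶠ[nhds 1] fun t : ℝ => (t : ℂ) ^ k * G x := by
    filter_upwards [lt_mem_nhds (zero_lt_one (α := ℝ))] with t ht using hk t ht
  rw [h2.deriv.deriv_eq]
  have h3 : ∀ (j : ℕ) (a : ℂ) (t : ℝ),
      HasDerivAt (fun t : ℝ => (t : ℂ) ^ j * a) (j * (t : ℂ) ^ (j - 1) * a) t := fun j a t => by
    simpa using ((Complex.ofRealCLM.hasDerivAt (x := t)).pow j).mul_const a
  rw [funext fun t => (h3 k (G x) t).deriv]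
  rcases k with _ | k
  · simp
  · have h4 := (h3 k ((k + 1 : ℕ) * G x) 1).deriv
    rw [show (fun t : ℝ => ((k + 1 : ℕ) : ℂ) * (t : ℂ) ^ (k + 1 - 1) * G x) =
      fun t : ℝ => (t : ℂ) ^ k * (((k + 1 : ℕ) : ℂ) * G x) from by
        funext t; rw [Nat.add_sub_cancel]; ring, h4]
    push_cast
    simp
    ring

end SecondDerivatives

/-! ### The spherical Laplacian in terms of ambient derivatives. -/

section SphereCalculus

variable {E : Type*} [NormedAddCommGroup E] [InnerProductSpace ℝ E] {m : ℕ}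
  [Fact (Module.finrank ℝ E = m + 1)]

/-- The isometric identification of `ℝ^m` with the tangent space of the sphere at `x` that
underlies the stereographic chart. -/
def tangentFrame (x : Metric.sphere (0 : E) 1) : EuclideanSpace ℝ (Fin m) →ₗᵢ[ℝ] E :=
  (Submodule.span ℝ {((-x : Metric.sphere (0 : E) 1) : E)})ᗮ.subtypeₗᵢ.comp
    (OrthonormalBasis.fromOrthogonalSpanSingleton m
      (ne_zero_of_mem_unit_sphere (-x))).repr.symm.toLinearIsometry

theorem inner_tangentFrame (x : Metric.sphere (0 : E) 1) (u : EuclideanSpace ℝ (Fin m)) :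
    inner ℝ (x : E) (tangentFrame x u) = 0 := by
  have h : tangentFrame x u ∈ (Submodule.span ℝ {((-x : Metric.sphere (0 : E) 1) : E)})ᗮ :=
    Subtype.property _
  rw [Submodule.mem_orthogonal_singleton_iff_inner_right] at h
  simpa using h

/-- The chart at x projects stereographically from -x, so x has coordinate 0. Writing the
coefficient of x as 8/(‖u‖² + 4) - 1 leaves a single scalar factor to differentiate. -/
theorem param_coe (x : Metric.sphere (0 : E) 1) (u : EuclideanSpace ℝ (Fin m)) :
    (param x u : E) =
      (‖u‖ ^ 2 + 4)⁻¹ • ((4 : ℝ) • tangentFrame x u + (8 : ℝ) • (x : E)) - (x : E) := by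
  have h := stereographic'_symm_apply (-x) u
  change (param x u : E) = _ at h
  rw [h]
  change (‖tangentFrame x u‖ ^ 2 + 4)⁻¹ • (4 : ℝ) • tangentFrame x u +
    (‖tangentFrame x u‖ ^ 2 + 4)⁻¹ • (‖tangentFrame x u‖ ^ 2 - 4) •
      ((-x : Metric.sphere (0 : E) 1) : E) = _
  rw [LinearIsometry.norm_map]
  have : ‖u‖ ^ 2 + 4 ≠ 0 := by positivity
  have hx : (‖u‖ ^ 2 + 4)⁻¹ * (4 - ‖u‖ ^ 2) = (‖u‖ ^ 2 + 4)⁻¹ * 8 - 1 := by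
    field_simp
    ring
  have hx' : (‖u‖ ^ 2 + 4)⁻¹ • (‖u‖ ^ 2 - 4) • ((-x : Metric.sphere (0 : E) 1) : E) =
      ((‖u‖ ^ 2 + 4)⁻¹ * (4 - ‖u‖ ^ 2)) • (x : E) := by
    rw [show ((-x : Metric.sphere (0 : E) 1) : E) = -(x : E) from rfl]
    module
  rw [hx', hx]
  module

theorem chartAt_self (x : Metric.sphere (0 : E) 1) :
    chartAt (EuclideanSpace ℝ (Fin m)) x x = 0 := by
  change (OrthonormalBasis.fromOrthogonalSpanSingleton m
      (ne_zero_of_mem_unit_sphere (-x))).repr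
      (stereographic (norm_eq_of_mem_sphere (-x)) x) = 0
  rw [stereographic_neg_apply x, map_zero]

theorem fderiv_param_apply (x : Metric.sphere (0 : E) 1) (u e : EuclideanSpace ℝ (Fin m)) :
    fderiv ℝ (fun w => (param x w : E)) u e =
      (-(2 * inner ℝ u e * ((‖u‖ ^ 2 + 4)⁻¹) ^ 2)) •
        ((4 : ℝ) • tangentFrame x u + (8 : ℝ) • (x : E)) +
      (4 * (‖u‖ ^ 2 + 4)⁻¹) • tangentFrame x e := by
  have h0 : ‖u‖ ^ 2 + 4 ≠ 0 := by positivity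
  have h1 : HasFDerivAt (fun w : EuclideanSpace ℝ (Fin m) => (‖w‖ ^ 2 + 4)⁻¹) _ u :=
    (hasDerivAt_inv h0).comp_hasFDerivAt u
      ((hasStrictFDerivAt_norm_sq u).hasFDerivAt.add_const 4)
  have h2 : HasFDerivAt (fun w : EuclideanSpace ℝ (Fin m) =>
      (4 : ℝ) • tangentFrame x w + (8 : ℝ) • (x : E)) _ u :=
    ((tangentFrame x).toContinuousLinearMap.hasFDerivAt.const_smul (4 : ℝ)).add_const _
  have h3 := (h1.fun_smul h2).sub_const (x : E)
  simp only [param_coe]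
  rw [h3.fderiv]
  simp
  module

/-- Stereographic projection is conformal. As the factor depends on ‖u‖² alone, the metric is
Euclidean to first order at 0, so the Christoffel symbols vanish there. -/
theorem metricCoeff_eq (x : Metric.sphere (0 : E) 1) (u : EuclideanSpace ℝ (Fin m)) :
    metricCoeff x u = (16 * ((‖u‖ ^ 2 + 4)⁻¹) ^ 2) • (1 : Matrix (Fin m) (Fin m) ℝ) := by
  ext i j
  have h0 : ‖u‖ ^ 2 + 4 ≠ 0 := by positivity
  have hx : inner ℝ (x : E) (x : E) = 1 := by simp
  have hs : ∀ w : EuclideanSpace ℝ (Fin m), inner ℝ (tangentFrame x w) (x : E) = 0 := fun w => by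
    rw [real_inner_comm]; exact inner_tangentFrame x w
  have hij : inner ℝ (EuclideanSpace.single i (1 : ℝ)) (EuclideanSpace.single j (1 : ℝ)) =
      (1 : Matrix (Fin m) (Fin m) ℝ) i j := by
    simp [EuclideanSpace.inner_single_left, Matrix.one_apply]
  have hu : inner ℝ u u = ‖u‖ ^ 2 := real_inner_self_eq_norm_sq u
  simp only [metricCoeff, Matrix.of_apply, pderiv, fderiv_param_apply, inner_add_left,
    inner_add_right, inner_smul_left, inner_smul_right, LinearIsometry.inner_map_map,
    inner_tangentFrame, hs, hx, hij, hu, Matrix.smul_apply, smul_eq_mul, RCLike.conj_to_real]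
  rw [real_inner_comm u (EuclideanSpace.single i (1 : ℝ))]
  field_simp
  ring

theorem pderiv_metricCoeff_zero (x : Metric.sphere (0 : E) 1) (i j k : Fin m) :
    pderiv i (fun w => metricCoeff x w j k) 0 = 0 := by
  have h1 : HasFDerivAt (fun w : EuclideanSpace ℝ (Fin m) => (‖w‖ ^ 2 + 4)⁻¹) _ 0 :=
    (hasDerivAt_inv (by simp)).comp_hasFDerivAt 0
      ((hasStrictFDerivAt_norm_sq (0 : EuclideanSpace ℝ (Fin m))).hasFDerivAt.add_const 4)
  have h2 := (((h1.pow 2).const_mul 16).mul_const ((1 : Matrix (Fin m) (Fin m) ℝ) j k)).fderiv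
  simp only [metricCoeff_eq, Matrix.smul_apply, smul_eq_mul, pderiv]
  rw [h2]
  simp

theorem metricCoeff_zero (x : Metric.sphere (0 : E) 1) :
    metricCoeff x (0 : EuclideanSpace ℝ (Fin m)) = 1 := by
  rw [metricCoeff_eq]; norm_num

theorem laplaceBeltrami_eq_sum_pderiv (f : Metric.sphere (0 : E) 1 → ℂ)
    (x : Metric.sphere (0 : E) 1) :
    laplaceBeltrami m f x =
      -∑ i : Fin m, pderiv i (pderiv i fun w => f (param x w)) 0 := by
  have hc : ∀ k i j : Fin m, christoffel x k i j 0 = 0 := fun k i j => by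
    simp [christoffel, pderiv_metricCoeff_zero]
  simp only [laplaceBeltrami, chartAt_self, metricCoeff_zero, hc, inv_one, Matrix.one_apply]
  congr 1
  refine Finset.sum_congr rfl fun i _ => ?_
  rw [Finset.sum_eq_single i] <;> simp +contextual [eq_comm]

theorem pderiv_pderiv_eq_deriv_deriv {F : EuclideanSpace ℝ (Fin m) → ℂ} (hF : ContDiff ℝ ∞ F)
    (i : Fin m) :
    pderiv i (pderiv i F) 0 =
      deriv (deriv fun t : ℝ => F (t • EuclideanSpace.single i (1 : ℝ))) 0 := by
  have h : ∀ (H : EuclideanSpace ℝ (Fin m) → ℂ), ContDiff ℝ ∞ H → ∀ t : ℝ,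
      pderiv i H (t • EuclideanSpace.single i (1 : ℝ)) =
        deriv (fun t : ℝ => H (t • EuclideanSpace.single i (1 : ℝ))) t := fun H hH t => by
    have hc : HasDerivAt (fun t : ℝ => t • EuclideanSpace.single i (1 : ℝ))
        (EuclideanSpace.single i (1 : ℝ)) t := by
      simpa using (hasDerivAt_id t).smul_const (EuclideanSpace.single i (1 : ℝ))
    exact ((hH.differentiable (by simp) _).hasFDerivAt.comp_hasDerivAt t hc).deriv.symm
  have h1 := h _ (contDiff_pderiv hF i) 0
  rw [zero_smul] at h1
  rw [h1]
  congr 1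
  funext t
  exact h F hF t

/-- The image c of a coordinate line satisfies c(0) = x, c'(0) = e, c''(0) = -x. The acceleration,
normal to the sphere, produces the first-order term. -/
theorem pderiv_pderiv_comp_param {G : E → ℂ} {f : Metric.sphere (0 : E) 1 → ℂ}
    (hf : ContMDiff (𝓡 m) 𝓘(ℝ, ℂ) ∞ f) (hfG : ∀ y, f y = G y) (x : Metric.sphere (0 : E) 1)
    (hG : ContDiffAt ℝ 2 G (x : E)) (i : Fin m) :
    pderiv i (pderiv i fun w => f (param x w)) 0 =
      fderiv ℝ (fderiv ℝ G) (x : E) (tangentFrame x (EuclideanSpace.single i (1 : ℝ)))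
        (tangentFrame x (EuclideanSpace.single i (1 : ℝ))) - fderiv ℝ G (x : E) (x : E) := by
  rw [pderiv_pderiv_eq_deriv_deriv (contDiff_comp_param hf x)]
  set e := tangentFrame x (EuclideanSpace.single i (1 : ℝ)) with he
  let c : ℝ → E := fun t => (t ^ 2 + 4)⁻¹ • ((4 * t) • e + (8 : ℝ) • (x : E)) - (x : E)
  let c' : ℝ → E := fun t => (t ^ 2 + 4)⁻¹ • ((4 : ℝ) • e) +
    (-(2 * t) * ((t ^ 2 + 4)⁻¹) ^ 2) • ((4 * t) • e + (8 : ℝ) • (x : E))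
  have hq : ∀ t : ℝ, HasDerivAt (fun t : ℝ => (t ^ 2 + 4)⁻¹)
      (-(2 * t) * ((t ^ 2 + 4)⁻¹) ^ 2) t := fun t => by
    have h0 : t ^ 2 + 4 ≠ 0 := by positivity
    refine ((((hasDerivAt_id t).fun_pow 2).add_const 4).fun_inv h0).congr_deriv ?_
    simp
    field_simp
  have hl : ∀ t : ℝ, HasDerivAt (fun t : ℝ => (4 * t) • e + (8 : ℝ) • (x : E))
      ((4 : ℝ) • e) t := fun t => by
    simpa using (((hasDerivAt_id t).const_mul 4).smul_const e).add_const ((8 : ℝ) • (x : E))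
  have hc : ∀ t, HasDerivAt c (c' t) t := fun t => ((hq t).smul (hl t)).sub_const _
  have hc' : HasDerivAt c' (-(x : E)) 0 := by
    have h1 : HasDerivAt (fun t : ℝ => -(2 * t)) (-2) 0 := by
      simpa using ((hasDerivAt_id (0 : ℝ)).const_mul 2).fun_neg
    have h2 := ((hq 0).smul_const ((4 : ℝ) • e)).fun_add
      ((h1.fun_mul ((hq 0).fun_pow 2)).fun_smul (hl 0))
    convert h2 using 1
    simp [smul_smul]
    norm_num
  have hc0 : c 0 = x := by simp only [c]; norm_num; module
  have hc0' : c' 0 = e := by simp only [c']; norm_num; module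
  have hfc : (fun t : ℝ => f (param x (t • EuclideanSpace.single i (1 : ℝ)))) =
      fun t => G (c t) := by
    funext t
    rw [hfG, param_coe]
    congr 1
    simp only [c, map_smul, norm_smul]
    simp [mul_smul, he]
  rw [hfc, deriv_deriv_comp (by rwa [hc0]) (Filter.Eventually.of_forall hc) hc', hc0, hc0',
    map_neg, sub_eq_add_neg]

/-- A unit vector and an orthonormal frame of its tangent space form an orthonormal basis. -/
theorem exists_orthonormalBasis_tangentFrame (x : Metric.sphere (0 : E) 1) :
    ∃ b : OrthonormalBasis (Option (Fin m)) ℝ E, b none = (x : E) ∧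
      ∀ i, b (some i) = tangentFrame x (EuclideanSpace.single i (1 : ℝ)) := by
  let v : Option (Fin m) → E := fun o =>
    o.elim (x : E) fun i => tangentFrame x (EuclideanSpace.single i (1 : ℝ))
  have hv : Orthonormal ℝ v := by
    rw [orthonormal_iff_ite]
    rintro (_ | i) (_ | j)
    · simp [v]
    · simp [v, inner_tangentFrame]
    · simpa [v] using (real_inner_comm _ _).trans
        (inner_tangentFrame x (EuclideanSpace.single i (1 : ℝ)))
    · simp [v, LinearIsometry.inner_map_map, EuclideanSpace.inner_single_left]
  have hcard : Fintype.card (Option (Fin m)) = Module.finrank ℝ E := by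
    rw [Fintype.card_option, Fintype.card_fin, Fact.out (p := Module.finrank ℝ E = m + 1)]
  have hb := coe_basisOfOrthonormalOfCardEqFinrank hv hcard
  refine ⟨(basisOfOrthonormalOfCardEqFinrank hv hcard).toOrthonormalBasis (by rwa [hb]), ?_, ?_⟩
  · simp [hb, v]
  · intro i
    simp [hb, v]

open Laplacian in
/-- The spherical Laplacian of the restriction of a function of the ambient space. -/
theorem laplaceBeltrami_restrict [FiniteDimensional ℝ E] {G : E → ℂ}
    {f : Metric.sphere (0 : E) 1 → ℂ} (hf : ContMDiff (𝓡 m) 𝓘(ℝ, ℂ) ∞ f) (hfG : ∀ y, f y = G y)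
    (x : Metric.sphere (0 : E) 1) (hG : ContDiffAt ℝ 2 G (x : E)) :
    laplaceBeltrami m f x = -Δ G (x : E) + fderiv ℝ (fderiv ℝ G) (x : E) (x : E) (x : E) +
      m * fderiv ℝ G (x : E) (x : E) := by
  obtain ⟨b, hb, hb'⟩ := exists_orthonormalBasis_tangentFrame (m := m) x
  rw [laplaceBeltrami_eq_sum_pderiv,
    InnerProductSpace.laplacian_eq_iteratedFDeriv_orthonormalBasis G b]
  simp only [pderiv_pderiv_comp_param hf hfG x hG, iteratedFDeriv_two_apply, Fintype.sum_option,
    hb, hb', Finset.sum_sub_distrib]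
  simp
  ring

open Laplacian in
-- By Euler's identities the two radial terms contribute k(k - 1) and mk. For harmonic G only their
-- sum, the spherical eigenvalue, remains.
theorem laplaceBeltrami_restrict_of_homogeneous [FiniteDimensional ℝ E] {G : E → ℂ}
    {f : Metric.sphere (0 : E) 1 → ℂ} (hf : ContMDiff (𝓡 m) 𝓘(ℝ, ℂ) ∞ f) (hfG : ∀ y, f y = G y)
    (x : Metric.sphere (0 : E) 1) (hG : ContDiffAt ℝ 2 G (x : E)) {k : ℕ}
    (hk : ∀ t : ℝ, 0 < t → G (t • (x : E)) = (t : ℂ) ^ k * G x) :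
    laplaceBeltrami m f x = -Δ G (x : E) + k * (k + m - 1) * f x := by
  rw [laplaceBeltrami_restrict hf hfG x hG, fderiv_fderiv_apply_self_of_homogeneous hG hk,
    fderiv_apply_self_of_homogeneous (hG.differentiableAt (by simp)) hk, hfG]
  ring

end SphereCalculus

/-! ### Extension of functions from the sphere, constant on rays. -/

section RadialExtension

variable {E : Type*} [NormedAddCommGroup E] [InnerProductSpace ℝ E]

/-- The extension of a function on the unit sphere that is constant on open rays (with value `0` at
the origin). -/
def radialExt (f : Metric.sphere (0 : E) 1 → ℂ) (y : E) : ℂ :=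
  open Classical in
  if h : y = 0 then 0 else f ⟨‖y‖⁻¹ • y, by simp [norm_smul, h]⟩

theorem radialExt_of_ne (f : Metric.sphere (0 : E) 1 → ℂ) {y : E} (hy : y ≠ 0)
    (x : Metric.sphere (0 : E) 1) (hx : (x : E) = ‖y‖⁻¹ • y) : radialExt f y = f x := by
  rw [radialExt, dif_neg hy]
  exact congrArg f (Subtype.ext hx.symm)

theorem exists_sphere_eq {y : E} (hy : y ≠ 0) :
    ∃ x : Metric.sphere (0 : E) 1, (x : E) = ‖y‖⁻¹ • y :=
  ⟨⟨‖y‖⁻¹ • y, by simp [norm_smul, hy]⟩, rfl⟩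

@[simp]
theorem radialExt_zero (f : Metric.sphere (0 : E) 1 → ℂ) : radialExt f 0 = 0 := by
  simp [radialExt]

@[simp]
theorem radialExt_coe (f : Metric.sphere (0 : E) 1 → ℂ) (x : Metric.sphere (0 : E) 1) :
    radialExt f (x : E) = f x :=
  radialExt_of_ne f (ne_zero_of_mem_unit_sphere x) x (by simp)

theorem radialExt_smul (f : Metric.sphere (0 : E) 1 → ℂ) {t : ℝ} (ht : 0 < t) (y : E) :
    radialExt f (t • y) = radialExt f y := by
  by_cases hy : y = 0
  · simp [hy]
  obtain ⟨x, hx⟩ := exists_sphere_eq hy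
  rw [radialExt_of_ne f hy x hx, radialExt_of_ne f (smul_ne_zero ht.ne' hy) x]
  rw [hx, norm_smul, Real.norm_of_nonneg ht.le, smul_smul]
  congr 1
  field_simp

theorem continuousAt_radialExt {f : Metric.sphere (0 : E) 1 → ℂ} (hf : Continuous f) {y : E}
    (hy : y ≠ 0) : ContinuousAt (radialExt f) y := by
  have h : ContinuousOn (radialExt f) {0}ᶜ := by
    rw [continuousOn_iff_continuous_domRestrict]
    have h1 : Continuous fun z : ({0}ᶜ : Set E) =>
        (⟨‖(z : E)‖⁻¹ • (z : E), by simp [norm_smul, show (z : E) ≠ 0 from z.2]⟩ :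
          Metric.sphere (0 : E) 1) := by
      refine Continuous.subtype_mk ?_ _
      exact (continuous_subtype_val.norm.inv₀ fun z => norm_ne_zero_iff.2 z.2).smul
        continuous_subtype_val
    refine (hf.comp h1).congr fun z => ?_
    exact (radialExt_of_ne f z.2 _ rfl).symm
  exact h.continuousAt (isOpen_compl_singleton.mem_nhds hy)

/-- Near y the extension factors through normalisation, the stereographic formula (smooth on an open
set of the ambient space) and f in the chart. -/
theorem contDiffAt_radialExt {m : ℕ} [Fact (Module.finrank ℝ E = m + 1)]
    {f : Metric.sphere (0 : E) 1 → ℂ} (hf : ContMDiff (𝓡 m) 𝓘(ℝ, ℂ) ∞ f) {y : E} (hy : y ≠ 0) :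
    ContDiffAt ℝ ∞ (radialExt f) y := by
  obtain ⟨x, hx⟩ := exists_sphere_eq hy
  let U := (OrthonormalBasis.fromOrthogonalSpanSingleton (𝕜 := ℝ) m
    (ne_zero_of_mem_unit_sphere (-x))).repr
  let n : E → E := fun z => ‖z‖⁻¹ • z
  have hn : ContDiffAt ℝ ∞ n y :=
    ((contDiffAt_norm ℝ hy).inv (norm_ne_zero_iff.2 hy)).smul contDiffAt_id
  have hv : innerSL ℝ ((-x : Metric.sphere (0 : E) 1) : E) (n y) ≠ 1 := by
    change inner ℝ (-(x : E)) (‖y‖⁻¹ • y) ≠ 1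
    rw [← hx, inner_neg_left]
    simp
    norm_num
  have hopen : IsOpen {z : E | innerSL ℝ ((-x : Metric.sphere (0 : E) 1) : E) z ≠ 1} :=
    isOpen_ne_fun (innerSL ℝ ((-x : Metric.sphere (0 : E) 1) : E)).continuous continuous_const
  have hs : ContDiffAt ℝ ∞ (stereoToFun ((-x : Metric.sphere (0 : E) 1) : E)) (n y) :=
    contDiffOn_stereoToFun.contDiffAt (hopen.mem_nhds hv)
  have hF : ContDiffAt ℝ ∞ (fun z => f (param x (U (stereoToFun _ (n z))))) y :=
    (contDiff_comp_param hf x).contDiffAt.comp y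
      (U.toContinuousLinearEquiv.contDiff.contDiffAt.comp y (hs.comp y hn))
  refine hF.congr_of_eventuallyEq ?_
  filter_upwards [isOpen_compl_singleton.mem_nhds hy,
    hn.continuousAt.eventually (hopen.mem_nhds hv)] with z hz hz'
  obtain ⟨p, hp⟩ := exists_sphere_eq hz
  rw [radialExt_of_ne f hz p hp]
  congr 1
  have hsrc : p ∈ (chartAt (EuclideanSpace ℝ (Fin m)) x).source := by
    change p ∈ (stereographic' m (-x)).source
    rw [stereographic'_source, Set.mem_compl_singleton_iff]
    rintro rfl
    apply hz'
    change inner ℝ _ (‖z‖⁻¹ • z) = (1 : ℝ)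
    rw [← hp]
    simp
  have h := (chartAt (EuclideanSpace ℝ (Fin m)) x).left_inv hsrc
  rw [← h, param]
  congr 1
  change U (stereoToFun _ (p : E)) = _
  rw [hp]

theorem continuousAt_inv_norm_sq_mul_radialExt {f : Metric.sphere (0 : E) 1 → ℂ}
    (hf : Continuous f) {y : E} (hy : y ≠ 0) :
    ContinuousAt (fun y : E => ((‖y‖⁻¹ : ℝ) : ℂ) ^ 2 * radialExt f y) y :=
  ((Complex.continuous_ofReal.continuousAt.comp
    (continuousAt_id.norm.inv₀ (norm_ne_zero_iff.2 hy))).pow 2).mul (continuousAt_radialExt hf hy)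

theorem radialExt_add (f g : Metric.sphere (0 : E) 1 → ℂ) (y : E) :
    radialExt (fun x => f x + g x) y = radialExt f y + radialExt g y := by
  by_cases hy : y = 0 <;> simp [radialExt, hy]

theorem radialExt_mul (f g : Metric.sphere (0 : E) 1 → ℂ) (y : E) :
    radialExt (fun x => f x * g x) y = radialExt f y * radialExt g y := by
  by_cases hy : y = 0 <;> simp [radialExt, hy]

theorem radialExt_const_mul (c : ℂ) (f : Metric.sphere (0 : E) 1 → ℂ) (y : E) :
    radialExt (fun x => c * f x) y = c * radialExt f y := by
  by_cases hy : y = 0 <;> simp [radialExt, hy]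

end RadialExtension

section Laplacian

open Laplacian

variable {E : Type*} [NormedAddCommGroup E] [InnerProductSpace ℝ E] [FiniteDimensional ℝ E]

theorem laplacian_eq_sum_fderiv {ι : Type*} [Fintype ι] (b : OrthonormalBasis ι ℝ E) (G : E → ℂ)
    (y : E) : Δ G y = ∑ i, fderiv ℝ (fderiv ℝ G) y (b i) (b i) := by
  rw [InnerProductSpace.laplacian_eq_iteratedFDeriv_orthonormalBasis G b]
  simp [iteratedFDeriv_two_apply]

theorem laplacian_of_comp_smul_eq {G : E → ℂ} {c : ℝ} (hG : ∀ z, G (c • z) = G z) (y : E) :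
    Δ G y = c ^ 2 * Δ G (c • y) := by
  have h1 : fderiv ℝ G = fun z => c • fderiv ℝ G (c • z) := by
    funext z
    rw [← fderiv_comp_smul]
    simp only [hG]
  have h2 : fderiv ℝ (fderiv ℝ G) y = c • c • fderiv ℝ (fderiv ℝ G) (c • y) := by
    conv_lhs => rw [h1]
    rw [← fderiv_comp_smul]
    exact congrFun (fderiv_const_smul_field (f := fun z => fderiv ℝ G (c • z)) c) y
  rw [laplacian_eq_sum_fderiv (stdOrthonormalBasis ℝ E),
    laplacian_eq_sum_fderiv (stdOrthonormalBasis ℝ E), h2, Finset.mul_sum]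
  refine Finset.sum_congr rfl fun i _ => ?_
  simp
  ring

/-- On the unit sphere degree-0 homogeneity makes the radial terms vanish; elsewhere it rescales the
Laplacian by ‖y‖⁻². -/
theorem laplacian_radialExt {m : ℕ} [Fact (Module.finrank ℝ E = m + 1)]
    {f : Metric.sphere (0 : E) 1 → ℂ} (hf : ContMDiff (𝓡 m) 𝓘(ℝ, ℂ) ∞ f) {y : E} (hy : y ≠ 0) :
    Δ (radialExt f) y = -((‖y‖⁻¹ : ℝ) : ℂ) ^ 2 * radialExt (laplaceBeltrami m f) y := by
  obtain ⟨x, hx⟩ := exists_sphere_eq hy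
  have hpos : 0 < ‖y‖⁻¹ := inv_pos.2 (norm_pos_iff.2 hy)
  rw [laplacian_of_comp_smul_eq (fun z => radialExt_smul f hpos z) y,
    radialExt_of_ne _ hy x hx, ← hx,
    laplaceBeltrami_restrict_of_homogeneous (k := 0) hf (fun z => (radialExt_coe f z).symm) x
      (ContDiffAt.of_le (m := 2) (contDiffAt_radialExt hf (ne_zero_of_mem_unit_sphere x))
        (WithTop.coe_le_coe.2 (le_top : (2 : ℕ∞) ≤ ⊤)))
      (fun t ht => by simp [radialExt_smul f ht])]
  push_cast
  ring

end Laplacian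

/-! ### Integration over the sphere by means of a radial cutoff. -/

section Shell

variable {E : Type*} [NormedAddCommGroup E]

/-- A smooth radial function supported in the shell `1 ≤ ‖y‖² ≤ 3`. -/
def shellBump (y : E) : ℝ :=
  (⟨1 / 2, 1, by norm_num, by norm_num⟩ : ContDiffBump (2 : ℝ)) (‖y‖ ^ 2)

theorem shellBump_nonneg (y : E) : 0 ≤ shellBump y := ContDiffBump.nonneg _

theorem shellBump_eq_zero {y : E} (hy : 1 ≤ |‖y‖ ^ 2 - 2|) : shellBump y = 0 := by
  apply ContDiffBump.zero_of_le_dist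
  simpa [Real.dist_eq] using hy

theorem shellBump_eq_one {y : E} (hy : ‖y‖ ^ 2 = 2) : shellBump y = 1 := by
  apply ContDiffBump.one_of_mem_closedBall
  simp [hy]

theorem shellBump_eventuallyEq_zero : ∀ᶠ y : E in nhds 0, shellBump y = 0 := by
  filter_upwards [Metric.ball_mem_nhds (0 : E) one_pos] with y hy
  apply shellBump_eq_zero
  have h1 : ‖y‖ < 1 := by simpa using hy
  have h2 : ‖y‖ ^ 2 ≤ 1 := by nlinarith [norm_nonneg y]
  rw [abs_of_neg] <;> linarith

variable [InnerProductSpace ℝ E]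

theorem contDiff_shellBump : ContDiff ℝ ∞ (shellBump : E → ℝ) :=
  (ContDiffBump.contDiff _).comp (contDiff_norm_sq ℝ)

/-- The gradient of the cutoff is radial, hence orthogonal to the gradient of any function constant
on rays; Green's identity therefore sees no derivative of the cutoff. -/
theorem exists_fderiv_shellBump (y : E) :
    ∃ c : ℝ, ∀ v, fderiv ℝ (shellBump : E → ℝ) y v = c * inner ℝ y v := by
  let b : ContDiffBump (2 : ℝ) := ⟨1 / 2, 1, by norm_num, by norm_num⟩
  have hb : DifferentiableAt ℝ b (‖y‖ ^ 2) :=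
    (b.contDiff (n := 1)).differentiable (by simp) _
  have h : HasFDerivAt (shellBump : E → ℝ) _ y :=
    hb.hasDerivAt.comp_hasFDerivAt y (hasStrictFDerivAt_norm_sq y).hasFDerivAt
  refine ⟨deriv b (‖y‖ ^ 2) * 2, fun v => ?_⟩
  rw [h.fderiv]
  simp
  ring

theorem continuous_shellBump_mul {H : E → ℂ} (hH : ∀ y, y ≠ 0 → ContinuousAt H y) :
    Continuous fun y => (shellBump y : ℂ) * H y := by
  rw [continuous_iff_continuousAt]
  intro y
  by_cases hy : y = 0
  · subst hy
    refine (continuousAt_const (y := (0 : ℂ))).congr ?_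
    filter_upwards [shellBump_eventuallyEq_zero] with z hz
    simp [hz]
  · exact (Complex.continuous_ofReal.comp contDiff_shellBump.continuous).continuousAt.mul (hH y hy)

theorem contDiff_shellBump_mul {H : E → ℂ} (hH : ∀ y, y ≠ 0 → ContDiffAt ℝ 1 H y) :
    ContDiff ℝ 1 fun y => (shellBump y : ℂ) * H y := by
  rw [contDiff_iff_contDiffAt]
  intro y
  by_cases hy : y = 0
  · subst hy
    refine (contDiffAt_const (c := (0 : ℂ))).congr_of_eventuallyEq ?_
    filter_upwards [shellBump_eventuallyEq_zero] with z hz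
    simp [hz]
  · exact (Complex.ofRealCLM.contDiff.contDiffAt.comp y
      (ContDiffAt.of_le contDiff_shellBump.contDiffAt (by simp))).mul (hH y hy)

variable [FiniteDimensional ℝ E]

theorem hasCompactSupport_shellBump_mul (H : E → ℂ) :
    HasCompactSupport fun y => (shellBump y : ℂ) * H y := by
  refine HasCompactSupport.intro (isCompact_closedBall (0 : E) 2) fun y hy => ?_
  have h1 : 2 < ‖y‖ := by simpa using hy
  have h2 : shellBump y = 0 := by
    apply shellBump_eq_zero
    rw [abs_of_nonneg] <;> nlinarith
  simp [h2]

variable [MeasurableSpace E] [BorelSpace E]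

theorem integral_fderiv_apply_eq_zero {X : E → ℂ} (hX : ContDiff ℝ 1 X)
    (hc : HasCompactSupport X) (v : E) : ∫ y, fderiv ℝ X y v = 0 := by
  have hi : MeasureTheory.Integrable fun y => fderiv ℝ X y v :=
    ((hX.continuous_fderiv (by simp)).clm_apply continuous_const).integrable_of_hasCompactSupport
      (hc.fderiv_apply (𝕜 := ℝ) v)
  have h := integral_mul_fderiv_eq_neg_fderiv_mul_of_integrable (𝕜 := ℂ)
    (μ := MeasureTheory.volume) (f := fun _ : E => (1 : ℂ)) (g := X) (v := v)
    (by simp) (by simpa using hi)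
    (by simpa using hX.continuous.integrable_of_hasCompactSupport hc)
    (fun x _ => differentiableAt_const _) (fun x _ => hX.differentiable (by simp) x)
  simpa using h

/-- A rotation invariant integral over the unit sphere (up to a constant factor, integration with
respect to the surface measure), written as an integral over a shell. -/
def sphereIntegral (f : Metric.sphere (0 : E) 1 → ℂ) : ℂ :=
  ∫ y : E, (shellBump y : ℂ) * (((‖y‖⁻¹ : ℝ) : ℂ) ^ 2 * radialExt f y)

theorem integrable_sphereIntegrand {f : Metric.sphere (0 : E) 1 → ℂ} (hf : Continuous f) :
    MeasureTheory.Integrable fun y : E =>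
      (shellBump y : ℂ) * (((‖y‖⁻¹ : ℝ) : ℂ) ^ 2 * radialExt f y) :=
  (continuous_shellBump_mul fun _ hy =>
    continuousAt_inv_norm_sq_mul_radialExt hf hy).integrable_of_hasCompactSupport
    (hasCompactSupport_shellBump_mul _)

theorem sphereIntegral_add {f g : Metric.sphere (0 : E) 1 → ℂ} (hf : Continuous f)
    (hg : Continuous g) :
    sphereIntegral (fun x => f x + g x) = sphereIntegral f + sphereIntegral g := by
  simp only [sphereIntegral]
  rw [← MeasureTheory.integral_add (integrable_sphereIntegrand hf) (integrable_sphereIntegrand hg)]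
  congr 1
  funext y
  rw [radialExt_add]
  ring

theorem sphereIntegral_const_mul (c : ℂ) (f : Metric.sphere (0 : E) 1 → ℂ) :
    sphereIntegral (fun x => c * f x) = c * sphereIntegral f := by
  simp only [sphereIntegral]
  rw [← MeasureTheory.integral_const_mul]
  congr 1
  funext y
  rw [radialExt_const_mul]
  ring

theorem exists_norm_sphereIntegral_le :
    ∃ C : ℝ, ∀ (f : Metric.sphere (0 : E) 1 → ℂ) (M : ℝ), (∀ x, ‖f x‖ ≤ M) →
      ‖sphereIntegral f‖ ≤ C * M := by
  have hi := (integrable_sphereIntegrand (E := E) (f := fun _ => 1) continuous_const).norm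
  refine ⟨∫ y : E, ‖(shellBump y : ℂ) * (((‖y‖⁻¹ : ℝ) : ℂ) ^ 2 * radialExt (fun _ => 1) y)‖,
    fun f M hM => ?_⟩
  rw [← MeasureTheory.integral_mul_const]
  refine MeasureTheory.norm_integral_le_of_norm_le (hi.mul_const M)
    (Filter.Eventually.of_forall fun y => ?_)
  by_cases hy : y = 0
  · simp [hy]
  obtain ⟨x, hx⟩ := exists_sphere_eq hy
  rw [radialExt_of_ne f hy x hx, radialExt_of_ne (fun _ => 1) hy x hx, norm_mul, norm_mul,
    norm_mul, norm_mul, norm_one, mul_one, ← mul_assoc]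
  exact mul_le_mul_of_nonneg_left (hM x) (by positivity)

/-- The integrand is continuous and non-negative, and at √2 x, where the cutoff is 1, it equals ‖f
x‖²/2. -/
theorem eq_zero_of_sphereIntegral_conj_mul_self {f : Metric.sphere (0 : E) 1 → ℂ}
    (hf : Continuous f)
    (h0 : sphereIntegral (fun x => f x * (starRingEnd ℂ) (f x)) = 0)
    (x : Metric.sphere (0 : E) 1) : f x = 0 := by
  let F : E → ℝ := fun y => shellBump y * (‖y‖⁻¹ ^ 2 * ‖radialExt f y‖ ^ 2)
  have hconj : ∀ y : E, radialExt (fun x => f x * (starRingEnd ℂ) (f x)) y =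
      ((‖radialExt f y‖ ^ 2 : ℝ) : ℂ) := fun y => by
    by_cases hy : y = 0
    · simp [hy]
    obtain ⟨z, hz⟩ := exists_sphere_eq hy
    rw [radialExt_of_ne _ hy z hz, radialExt_of_ne _ hy z hz, Complex.mul_conj,
      Complex.normSq_eq_norm_sq]
  have hF : ∀ y : E, (F y : ℂ) = (shellBump y : ℂ) * (((‖y‖⁻¹ : ℝ) : ℂ) ^ 2 *
      radialExt (fun x => f x * (starRingEnd ℂ) (f x)) y) := fun y => by
    rw [hconj]
    simp [F]
  have hcont : Continuous fun x => f x * (starRingEnd ℂ) (f x) :=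
    hf.mul (Complex.continuous_conj.comp hf)
  have hFr : F = fun y => ((shellBump y : ℂ) * (((‖y‖⁻¹ : ℝ) : ℂ) ^ 2 *
      radialExt (fun x => f x * (starRingEnd ℂ) (f x)) y)).re := by
    funext y
    rw [← hF, Complex.ofReal_re]
  have hFc : Continuous F := by
    rw [hFr]
    exact Complex.continuous_re.comp (continuous_shellBump_mul fun _ hy =>
      continuousAt_inv_norm_sq_mul_radialExt hcont hy)
  have hFs : HasCompactSupport F := by
    rw [hFr]
    exact (hasCompactSupport_shellBump_mul _).comp_left Complex.zero_re
  have hF0 : ∫ y, F y = 0 := by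
    have : ((∫ y, F y : ℝ) : ℂ) = 0 := by
      rw [← integral_complex_ofReal, ← h0, sphereIntegral]
      congr 1
      funext y
      exact hF y
    exact_mod_cast this
  by_contra hx
  have hs2 : (0 : ℝ) < √2 := by positivity
  have hne : F (√2 • (x : E)) ≠ 0 := by
    have hn : ‖√2 • (x : E)‖ = √2 := by simp [norm_smul]
    have hb : shellBump (√2 • (x : E)) = 1 := shellBump_eq_one (by rw [hn]; norm_num)
    simp only [F, hb, hn, radialExt_smul f hs2, radialExt_coe]
    positivity
  exact (hFc.integral_pos_of_hasCompactSupport_nonneg_nonzero hFs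
    (fun y => mul_nonneg (shellBump_nonneg y) (by positivity)) hne).ne' hF0

theorem sphereIntegral_comp_isometry (A : E ≃ₗᵢ[ℝ] E)
    {σ : Metric.sphere (0 : E) 1 → Metric.sphere (0 : E) 1} (hσ : ∀ x, (σ x : E) = A x)
    (f : Metric.sphere (0 : E) 1 → ℂ) : sphereIntegral (fun x => f (σ x)) = sphereIntegral f := by
  refine Eq.trans ?_ (A.measurePreserving.integral_comp A.toHomeomorph.measurableEmbedding _)
  rw [sphereIntegral]
  congr 1
  funext y
  by_cases hy : y = 0
  · simp [hy]
  obtain ⟨x, hx⟩ := exists_sphere_eq hy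
  have hb : shellBump (A y) = shellBump y := by simp [shellBump]
  have hAy : A y ≠ 0 := by simpa using hy
  rw [hb, A.norm_map, radialExt_of_ne _ hy x hx, radialExt_of_ne _ hAy (σ x)]
  rw [hσ, hx, map_smul, A.norm_map]

end Shell

/-! ### Green's identity. -/

section Symmetry

open Laplacian

variable {E : Type*} [NormedAddCommGroup E] [InnerProductSpace ℝ E] [FiniteDimensional ℝ E]

/-- The divergence of ψ(G∇F - F∇G) for the cutoff ψ: the products ∇F·∇G cancel, and the ∇ψ terms
vanish because ∇ψ is radial while F and G have zero radial derivative. -/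
theorem sum_fderiv_shellBump_mul_wronskian {ι : Type*} [Fintype ι] (b : OrthonormalBasis ι ℝ E)
    {F G : E → ℂ} {y : E} (hF : ContDiffAt ℝ 2 F y) (hG : ContDiffAt ℝ 2 G y)
    (hFy : fderiv ℝ F y y = 0) (hGy : fderiv ℝ G y y = 0) :
    ∑ i, fderiv ℝ (fun z => (shellBump z : ℂ) *
        (G z * fderiv ℝ F z (b i) - F z * fderiv ℝ G z (b i))) y (b i) =
      (shellBump y : ℂ) * (G y * Δ F y - F y * Δ G y) := by
  obtain ⟨c, hc⟩ := exists_fderiv_shellBump y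
  have hd : ∀ {H : E → ℂ} (v : E), ContDiffAt ℝ 2 H y →
      HasFDerivAt (fun z => fderiv ℝ H z v) ((fderiv ℝ (fderiv ℝ H) y).flip v) y := fun {H} v hH =>
    by
      have h := ((hH.fderiv_right (m := 1) (by norm_num)).differentiableAt
        (by simp)).hasFDerivAt.clm_apply (hasFDerivAt_const v y)
      simpa using h
  have hterm : ∀ i, fderiv ℝ (fun z => (shellBump z : ℂ) *
        (G z * fderiv ℝ F z (b i) - F z * fderiv ℝ G z (b i))) y (b i) =
      (shellBump y : ℂ) * (G y * fderiv ℝ (fderiv ℝ F) y (b i) (b i) -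
        F y * fderiv ℝ (fderiv ℝ G) y (b i) (b i)) +
      (c * G y) * ((inner ℝ (b i) y : ℝ) * fderiv ℝ F y (b i)) -
      (c * F y) * ((inner ℝ (b i) y : ℝ) * fderiv ℝ G y (b i)) := fun i => by
    have hψ : HasFDerivAt (fun z : E => (shellBump z : ℂ))
        (Complex.ofRealCLM.comp (fderiv ℝ shellBump y)) y :=
      Complex.ofRealCLM.hasFDerivAt.comp y
        (contDiff_shellBump.differentiable (by simp) y).hasFDerivAt
    have hF1 := (hF.differentiableAt (by simp)).hasFDerivAt
    have hG1 := (hG.differentiableAt (by simp)).hasFDerivAt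
    rw [(hψ.fun_mul ((hG1.fun_mul (hd (b i) hF)).fun_sub (hF1.fun_mul (hd (b i) hG)))).fderiv]
    simp [hc, real_inner_comm]
    ring
  have hsum : ∀ H : E → ℂ, ∑ i, ((inner ℝ (b i) y : ℝ) : ℂ) * fderiv ℝ H y (b i) =
      fderiv ℝ H y y := fun H => by
    conv_rhs => rw [← b.sum_repr' y, map_sum]
    refine Finset.sum_congr rfl fun i _ => ?_
    rw [b.sum_repr' y]
    simp
  simp only [hterm, Finset.sum_add_distrib, Finset.sum_sub_distrib, ← Finset.mul_sum, hsum, hFy,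
    hGy, laplacian_eq_sum_fderiv b]
  simp

variable [MeasurableSpace E] [BorelSpace E]

/-- The spherical Laplacian is symmetric. -/
theorem sphereIntegral_laplaceBeltrami_symm {m : ℕ} [Fact (Module.finrank ℝ E = m + 1)]
    {f g : Metric.sphere (0 : E) 1 → ℂ}
    (hf : ContMDiff (𝓡 m) 𝓘(ℝ, ℂ) ∞ f) (hg : ContMDiff (𝓡 m) 𝓘(ℝ, ℂ) ∞ g) :
    sphereIntegral (fun x => g x * laplaceBeltrami m f x + -1 * (f x * laplaceBeltrami m g x)) =
      0 := by
  let b := stdOrthonormalBasis ℝ E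
  set F := radialExt f with hFdef
  set G := radialExt g with hGdef
  have hF : ∀ y, y ≠ 0 → ContDiffAt ℝ 2 F y := fun y hy =>
    (contDiffAt_radialExt hf hy).of_le (WithTop.coe_le_coe.2 (le_top : (2 : ℕ∞) ≤ ⊤))
  have hG : ∀ y, y ≠ 0 → ContDiffAt ℝ 2 G y := fun y hy =>
    (contDiffAt_radialExt hg hy).of_le (WithTop.coe_le_coe.2 (le_top : (2 : ℕ∞) ≤ ⊤))
  let X : Fin (Module.finrank ℝ E) → E → ℂ := fun i z => (shellBump z : ℂ) *
    (G z * fderiv ℝ F z (b i) - F z * fderiv ℝ G z (b i))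
  have hX : ∀ i, ContDiff ℝ 1 (X i) := fun i => contDiff_shellBump_mul fun y hy => by
    have h1 : ContDiffAt ℝ 1 (fun z => fderiv ℝ F z (b i)) y :=
      ((hF y hy).fderiv_right (m := 1) (by norm_num)).clm_apply contDiffAt_const
    have h2 : ContDiffAt ℝ 1 (fun z => fderiv ℝ G z (b i)) y :=
      ((hG y hy).fderiv_right (m := 1) (by norm_num)).clm_apply contDiffAt_const
    exact (((hG y hy).of_le (by norm_num)).mul h1).sub (((hF y hy).of_le (by norm_num)).mul h2)
  have hXc : ∀ i, HasCompactSupport (X i) := fun i => hasCompactSupport_shellBump_mul _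
  have hint : ∫ y, ∑ i, fderiv ℝ (X i) y (b i) = 0 := by
    rw [MeasureTheory.integral_finsetSum]
    · exact Finset.sum_eq_zero fun i _ => integral_fderiv_apply_eq_zero (hX i) (hXc i) (b i)
    · exact fun i _ => (((hX i).continuous_fderiv (by simp)).clm_apply
        continuous_const).integrable_of_hasCompactSupport ((hXc i).fderiv_apply (𝕜 := ℝ) (b i))
  -- The factor ‖y‖⁻² in `sphereIntegral` is the one relating Δ of a radial extension to
  -- `laplaceBeltrami`, so the negated integrand is exactly the divergence of X.
  rw [sphereIntegral, ← neg_eq_zero, ← MeasureTheory.integral_neg, ← hint]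
  congr 1
  funext y
  by_cases hy : y = 0
  · subst hy
    have : ∀ i, fderiv ℝ (X i) 0 = 0 := fun i => by
      have h : X i =ᶠ[nhds 0] fun _ => 0 := by
        filter_upwards [shellBump_eventuallyEq_zero] with z hz
        simp [X, hz]
      rw [h.fderiv_eq]
      simp
    simp [this]
  · have hE : ∀ h : Metric.sphere (0 : E) 1 → ℂ, ∀ t : ℝ, 0 < t →
        radialExt h (t • y) = (t : ℂ) ^ 0 * radialExt h y := fun h t ht => by
      rw [radialExt_smul h ht, pow_zero, one_mul]
    have hFy : fderiv ℝ F y y = 0 := by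
      simpa using fderiv_apply_self_of_homogeneous ((hF y hy).differentiableAt (by simp)) (hE f)
    have hGy : fderiv ℝ G y y = 0 := by
      simpa using fderiv_apply_self_of_homogeneous ((hG y hy).differentiableAt (by simp)) (hE g)
    rw [sum_fderiv_shellBump_mul_wronskian b (hF y hy) (hG y hy) hFy hGy,
      laplacian_radialExt hf hy, laplacian_radialExt hg hy, radialExt_add, radialExt_mul,
      radialExt_const_mul, radialExt_mul]
    ring

end Symmetry

/-! ### Polynomials in z_j and conj z_j on the ambient space. -/

section Polynomials

variable {n : ℕ}

/-- The complex coordinates `z_j = x_{0j} + i x_{1j}` (index `(0, j)`) and their conjugates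
(index `(1, j)`) on `ℝ^{2n}`. -/
def planeCoord (c : Fin 2 × Fin n) : EuclideanSpace ℝ (Fin 2 × Fin n) →L[ℝ] ℂ :=
  Complex.ofRealCLM.comp (EuclideanSpace.proj (0, c.2)) +
    (if c.1 = 0 then Complex.I else -Complex.I) •
      Complex.ofRealCLM.comp (EuclideanSpace.proj (1, c.2))

theorem planeCoord_apply (c : Fin 2 × Fin n) (x : EuclideanSpace ℝ (Fin 2 × Fin n)) :
    planeCoord c x = (x (0, c.2) : ℂ) +
      (if c.1 = 0 then Complex.I else -Complex.I) * (x (1, c.2) : ℂ) := rfl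

theorem conj_planeCoord (c : Fin 2 × Fin n) (x : EuclideanSpace ℝ (Fin 2 × Fin n)) :
    (starRingEnd ℂ) (planeCoord c x) = planeCoord (1 - c.1, c.2) x := by
  obtain ⟨a, j⟩ := c
  fin_cases a <;> simp [planeCoord_apply]

/-- The function on `ℝ^{2n}` that a polynomial in the `z_j` and their conjugates defines. -/
def polyFun (p : MvPolynomial (Fin 2 × Fin n) ℂ) (x : EuclideanSpace ℝ (Fin 2 × Fin n)) : ℂ :=
  MvPolynomial.eval (fun c => planeCoord c x) p

theorem contDiff_polyFun (p : MvPolynomial (Fin 2 × Fin n) ℂ) {k : ℕ∞ω} :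
    ContDiff ℝ k (polyFun p) := by
  induction p using MvPolynomial.induction_on with
  | C a =>
    rw [show polyFun (MvPolynomial.C a) = fun _ : EuclideanSpace ℝ (Fin 2 × Fin n) => a from
      funext fun x => by simp [polyFun]]
    exact contDiff_const
  | add p q hp hq =>
    rw [show polyFun (p + q) = fun x => polyFun p x + polyFun q x from
      funext fun x => by simp [polyFun]]
    exact hp.add hq
  | mul_X p c hp =>
    rw [show polyFun (p * MvPolynomial.X c) = fun x => polyFun p x * planeCoord c x from
      funext fun x => by simp [polyFun]]
    exact hp.mul (planeCoord c).contDiff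

theorem fderiv_polyFun_apply (p : MvPolynomial (Fin 2 × Fin n) ℂ)
    (x v : EuclideanSpace ℝ (Fin 2 × Fin n)) :
    fderiv ℝ (polyFun p) x v =
      ∑ c, planeCoord c v * polyFun (MvPolynomial.pderiv c p) x := by
  have hd : ∀ p : MvPolynomial (Fin 2 × Fin n) ℂ, DifferentiableAt ℝ (polyFun p) x := fun p =>
    (contDiff_polyFun p (k := 1)).differentiable (by simp) x
  induction p using MvPolynomial.induction_on with
  | C a =>
    rw [show polyFun (MvPolynomial.C a) = fun _ : EuclideanSpace ℝ (Fin 2 × Fin n) => a from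
      funext fun x => by simp [polyFun]]
    simp [polyFun]
  | add p q hp hq =>
    rw [show polyFun (p + q) = fun x => polyFun p x + polyFun q x from
      funext fun x => by simp [polyFun], fderiv_fun_add (hd p) (hd q)]
    simp only [add_apply, hp, hq, ← Finset.sum_add_distrib]
    simp [polyFun, mul_add]
  | mul_X p c hp =>
    rw [show polyFun (p * MvPolynomial.X c) = fun x => polyFun p x * planeCoord c x from
      funext fun x => by simp [polyFun], fderiv_fun_mul (hd p) (planeCoord c).differentiableAt]
    simp only [add_apply, smul_apply, hp,
      ContinuousLinearMap.fderiv, smul_eq_mul, Finset.mul_sum]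
    have h : ∀ d, planeCoord d v * polyFun (MvPolynomial.pderiv d (p * MvPolynomial.X c)) x =
        (if d = c then polyFun p x * planeCoord c v else 0) +
          planeCoord c x * (planeCoord d v * polyFun (MvPolynomial.pderiv d p) x) := fun d => by
      by_cases hdc : d = c
      · subst hdc
        simp [polyFun]
        ring
      · simp [polyFun, MvPolynomial.pderiv_X_of_ne (Ne.symm hdc), hdc]
        ring
    simp only [h, Finset.sum_add_distrib, Finset.sum_ite_eq', Finset.mem_univ, if_true]

/-- The operator `∑_j ∂_{z_j} ∂_{\bar z_j}`, a quarter of the Laplacian. -/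
def formalLaplacian (n : ℕ) :
    MvPolynomial (Fin 2 × Fin n) ℂ →ₗ[ℂ] MvPolynomial (Fin 2 × Fin n) ℂ :=
  ∑ j, (MvPolynomial.pderiv ((0 : Fin 2), j)).toLinearMap ∘ₗ
    (MvPolynomial.pderiv ((1 : Fin 2), j)).toLinearMap

/-- The polynomial `∑_j z_j \bar z_j`. -/
def normSqPoly (n : ℕ) : MvPolynomial (Fin 2 × Fin n) ℂ :=
  ∑ j, MvPolynomial.X (0, j) * MvPolynomial.X (1, j)

theorem polyFun_normSqPoly (x : EuclideanSpace ℝ (Fin 2 × Fin n)) :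
    polyFun (normSqPoly n) x = ((‖x‖ ^ 2 : ℝ) : ℂ) := by
  rw [EuclideanSpace.real_norm_sq_eq, Fintype.sum_prod_type_right]
  simp only [polyFun, normSqPoly, map_sum, map_mul, MvPolynomial.eval_X, planeCoord_apply,
    Fin.sum_univ_two]
  push_cast
  refine Finset.sum_congr rfl fun j _ => ?_
  simp
  linear_combination (-(x (1, j) : ℂ) ^ 2) * Complex.I_sq

theorem polyFun_mul (p q : MvPolynomial (Fin 2 × Fin n) ℂ)
    (x : EuclideanSpace ℝ (Fin 2 × Fin n)) : polyFun (p * q) x = polyFun p x * polyFun q x := by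
  simp [polyFun]

open Laplacian in
theorem laplacian_polyFun (p : MvPolynomial (Fin 2 × Fin n) ℂ)
    (x : EuclideanSpace ℝ (Fin 2 × Fin n)) :
    Δ (polyFun p) x = 4 * polyFun (formalLaplacian n p) x := by
  have h2 : ∀ v, fderiv ℝ (fderiv ℝ (polyFun p)) x v v = ∑ c, ∑ d, planeCoord c v *
      planeCoord d v * polyFun (MvPolynomial.pderiv d (MvPolynomial.pderiv c p)) x := fun v => by
    have hd : HasFDerivAt (fun y => fderiv ℝ (polyFun p) y v)
        ((fderiv ℝ (fderiv ℝ (polyFun p)) x).flip v) x := by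
      simpa using (((contDiff_polyFun p (k := 2)).fderiv_right (m := 1)
        (by norm_num)).differentiable (by simp) x).hasFDerivAt.clm_apply (hasFDerivAt_const v x)
    have h3 : fderiv ℝ (fderiv ℝ (polyFun p)) x v v =
        fderiv ℝ (fun y => fderiv ℝ (polyFun p) y v) x v := by
      rw [hd.fderiv]; rfl
    simp only [fderiv_polyFun_apply p] at h3
    have hd' : ∀ p : MvPolynomial (Fin 2 × Fin n) ℂ, DifferentiableAt ℝ (polyFun p) x := fun p =>
      (contDiff_polyFun p (k := 1)).differentiable (by simp) x
    rw [h3, fderiv_fun_sum fun c _ => (hd' _).const_mul _]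
    simp only [sum_apply]
    refine Finset.sum_congr rfl fun c _ => ?_
    rw [fderiv_const_mul (hd' _)]
    simp only [smul_apply, fderiv_polyFun_apply, smul_eq_mul, Finset.mul_sum]
    exact Finset.sum_congr rfl fun d _ => by ring
  rw [laplacian_eq_sum_fderiv (EuclideanSpace.basisFun (Fin 2 × Fin n) ℝ)]
  simp only [h2, EuclideanSpace.basisFun_apply]
  rw [Finset.sum_comm]
  -- The sum over i of the products of two coordinate forms is 2 for a conjugate pair and 0
  -- otherwise, so only d conjugate to c survives.
  have hc : ∀ c : Fin 2 × Fin n, ∑ i : Fin 2 × Fin n, ∑ d,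
      planeCoord c (EuclideanSpace.single i (1 : ℝ)) *
        planeCoord d (EuclideanSpace.single i (1 : ℝ)) *
        polyFun (MvPolynomial.pderiv d (MvPolynomial.pderiv c p)) x =
      2 * polyFun (MvPolynomial.pderiv (1 - c.1, c.2) (MvPolynomial.pderiv c p)) x := fun c => by
    rw [Finset.sum_comm, Finset.sum_eq_single (1 - c.1, c.2)]
    · rw [← Finset.sum_mul]
      congr 1
      rw [Fintype.sum_prod_type_right, Finset.sum_eq_single c.2]
      · obtain ⟨a, j⟩ := c
        fin_cases a <;> simp [planeCoord_apply] <;> norm_num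
      · intro j _ hj
        simp [planeCoord_apply, hj.symm]
      · simp
    · intro d _ hd
      rw [← Finset.sum_mul]
      refine mul_eq_zero_of_left ?_ _
      rw [Fintype.sum_prod_type_right]
      by_cases hcd : d.2 = c.2
      · rw [Finset.sum_eq_single c.2]
        · obtain ⟨a, j⟩ := c
          obtain ⟨a', j'⟩ := d
          simp only at hcd
          subst hcd
          fin_cases a <;> fin_cases a' <;> simp [planeCoord_apply] at hd ⊢
        · intro j _ hj
          simp [planeCoord_apply, hj.symm]
        · simp
      · refine Finset.sum_eq_zero fun j _ => ?_
        by_cases hj : c.2 = j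
        · subst hj
          simp [planeCoord_apply, hcd]
        · simp [planeCoord_apply, hj]
    · simp
  simp only [hc]
  rw [Fintype.sum_prod_type_right]
  simp only [formalLaplacian, polyFun, LinearMap.sum_apply, map_sum, Finset.mul_sum,
    Fin.sum_univ_two, LinearMap.comp_apply]
  refine Finset.sum_congr rfl fun j _ => ?_
  have hcomm : MvPolynomial.pderiv ((1 : Fin 2), j) (MvPolynomial.pderiv ((0 : Fin 2), j) p) =
      MvPolynomial.pderiv ((0 : Fin 2), j) (MvPolynomial.pderiv ((1 : Fin 2), j) p) := by
    have h : ⁅MvPolynomial.pderiv (R := ℂ) ((1 : Fin 2), j),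
        MvPolynomial.pderiv (R := ℂ) ((0 : Fin 2), j)⁆ = 0 := by
      refine MvPolynomial.derivation_ext fun c => ?_
      rw [Derivation.commutator_apply]
      by_cases h0 : c = (0, j) <;> by_cases h1 : c = (1, j) <;>
        simp [MvPolynomial.pderiv_X, h0, h1]
    have h' := congrArg (fun D => D p) h
    rwa [Derivation.commutator_apply, Derivation.zero_apply, sub_eq_zero] at h'
  simp [hcomm]
  ring

theorem polyFun_smul_of_isHomogeneous {p : MvPolynomial (Fin 2 × Fin n) ℂ} {k : ℕ}
    (hp : p.IsHomogeneous k) (t : ℝ) (x : EuclideanSpace ℝ (Fin 2 × Fin n)) :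
    polyFun p (t • x) = (t : ℂ) ^ k * polyFun p x := by
  simp only [polyFun, MvPolynomial.eval_eq, Finset.mul_sum]
  refine Finset.sum_congr rfl fun e he => ?_
  have hk : ∑ c ∈ e.support, e c = k := by
    have := hp (MvPolynomial.mem_support_iff.1 he)
    rwa [Finsupp.weight_apply, Finsupp.sum, show (∑ a ∈ e.support, e a • (1 : Fin 2 × Fin n → ℕ) a)
      = ∑ c ∈ e.support, e c by simp] at this
  simp only [map_smul, Complex.real_smul, mul_pow, Finset.prod_mul_distrib, Finset.prod_pow_eq_pow_sum,
    hk]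
  ring

theorem eval_bind₁ {σ : Type*} (y : σ → ℂ) (L : σ → MvPolynomial σ ℂ) (p : MvPolynomial σ ℂ) :
    MvPolynomial.eval y (MvPolynomial.bind₁ L p) =
      MvPolynomial.eval (fun c => MvPolynomial.eval y (L c)) p :=
  MvPolynomial.eval₂Hom_bind₁ _ _ _ _

/-- The substitution L expresses z_j and conj z_j through real coordinates. The substituted
polynomial vanishes at all real points, so it is zero, and L is invertible over ℂ. -/
theorem eq_zero_of_polyFun_eq_zero {p : MvPolynomial (Fin 2 × Fin n) ℂ}
    (hp : ∀ x, polyFun p x = 0) : p = 0 := by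
  let L : Fin 2 × Fin n → MvPolynomial (Fin 2 × Fin n) ℂ := fun c =>
    MvPolynomial.X (0, c.2) + MvPolynomial.C (if c.1 = 0 then Complex.I else -Complex.I) *
      MvPolynomial.X (1, c.2)
  have h1 : MvPolynomial.bind₁ L p = 0 := by
    refine MvPolynomial.funext_set (s := fun _ => Set.range ((↑) : ℝ → ℂ))
      (fun _ => Set.infinite_range_of_injective Complex.ofReal_injective) fun y hy => ?_
    choose x hx using fun c => hy c (Set.mem_univ c)
    rw [map_zero, ← hp (WithLp.toLp 2 x), polyFun, eval_bind₁]
    congr 2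
    funext c
    simp [L, planeCoord_apply, hx]
  refine MvPolynomial.funext fun z => ?_
  have h2 := congrArg (MvPolynomial.eval fun c : Fin 2 × Fin n =>
    if c.1 = 0 then (z (0, c.2) + z (1, c.2)) / 2
      else (z (0, c.2) - z (1, c.2)) / (2 * Complex.I)) h1
  rw [map_zero] at h2 ⊢
  rw [← h2, eval_bind₁]
  congr 2
  funext ⟨a, j⟩
  have hI := Complex.I_ne_zero
  fin_cases a <;> simp [L] <;> field_simp <;> ring

end Polynomials

/-! ### Polynomials restricted to the sphere, and their density. -/

section Polynomials

variable {n : ℕ}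

theorem contMDiff_polyFun_sphere {m : ℕ}
    [Fact (Module.finrank ℝ (EuclideanSpace ℝ (Fin 2 × Fin n)) = m + 1)]
    (p : MvPolynomial (Fin 2 × Fin n) ℂ) :
    ContMDiff (𝓡 m) 𝓘(ℝ, ℂ) ∞
      (fun x : Metric.sphere (0 : EuclideanSpace ℝ (Fin 2 × Fin n)) 1 => polyFun p x) :=
  (contDiff_polyFun p).contMDiff.comp contMDiff_coe_sphere

theorem continuous_polyFun_sphere (p : MvPolynomial (Fin 2 × Fin n) ℂ) :
    Continuous
      (fun x : Metric.sphere (0 : EuclideanSpace ℝ (Fin 2 × Fin n)) 1 => polyFun p x) :=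
  (contDiff_polyFun p (k := 0)).continuous.comp continuous_subtype_val

theorem laplaceBeltrami_polyFun {m : ℕ}
    [Fact (Module.finrank ℝ (EuclideanSpace ℝ (Fin 2 × Fin n)) = m + 1)]
    {p : MvPolynomial (Fin 2 × Fin n) ℂ} {k : ℕ} (hp : p.IsHomogeneous k)
    (x : Metric.sphere (0 : EuclideanSpace ℝ (Fin 2 × Fin n)) 1) :
    laplaceBeltrami m
      (fun x : Metric.sphere (0 : EuclideanSpace ℝ (Fin 2 × Fin n)) 1 => polyFun p x) x =
      -(4 * polyFun (formalLaplacian n p) x) + k * (k + m - 1) * polyFun p x := by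
  rw [← laplacian_polyFun]
  exact laplaceBeltrami_restrict_of_homogeneous (contMDiff_polyFun_sphere p) (fun _ => rfl) x
    (contDiff_polyFun p).contDiffAt fun t _ => polyFun_smul_of_isHomogeneous hp t x

/-- A continuous function on the sphere that is orthogonal to all polynomials vanishes. -/
theorem eq_zero_of_sphereIntegral_mul_polyFun
    {f : Metric.sphere (0 : EuclideanSpace ℝ (Fin 2 × Fin n)) 1 → ℂ} (hf : Continuous f)
    (h : ∀ p : MvPolynomial (Fin 2 × Fin n) ℂ, sphereIntegral (fun x => f x * polyFun p x) = 0)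
    (x : Metric.sphere (0 : EuclideanSpace ℝ (Fin 2 × Fin n)) 1) : f x = 0 := by
  let S := Metric.sphere (0 : EuclideanSpace ℝ (Fin 2 × Fin n)) 1
  let κ : Fin 2 × Fin n → C(S, ℂ) := fun c =>
    ⟨fun x => planeCoord c (x : EuclideanSpace ℝ (Fin 2 × Fin n)),
      (planeCoord c).continuous.comp continuous_subtype_val⟩
  let A : StarSubalgebra ℂ C(S, ℂ) := StarAlgebra.adjoin ℂ (Set.range κ)
  have hκ : ∀ c, star (κ c) = κ (1 - c.1, c.2) := fun c => by
    ext x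
    exact conj_planeCoord c x
  have hA : ∀ g ∈ A, ∃ p : MvPolynomial (Fin 2 × Fin n) ℂ, ∀ x : S, g x = polyFun p x := by
    intro g hg
    have hg' : g ∈ Algebra.adjoin ℂ (Set.range κ) := by
      have h1 : g ∈ A.toSubalgebra := hg
      -- Conjugation permutes the coordinates, so the star subalgebra they generate consists of
      -- polynomials in them.
      have h2 : Set.range κ ∪ star (Set.range κ) = Set.range κ := by
        refine Set.union_eq_left.2 ?_
        rintro y ⟨c, hc⟩
        exact ⟨(1 - c.1, c.2), by rw [← hκ, hc, star_star]⟩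
      rwa [StarAlgebra.adjoin_toSubalgebra, h2] at h1
    rw [Algebra.adjoin_range_eq_range_aeval] at hg'
    obtain ⟨p, rfl⟩ := hg'
    refine ⟨p, fun x => ?_⟩
    have h3 := MvPolynomial.map_aeval κ (ContinuousMap.evalAlgHom ℂ ℂ x : C(S, ℂ) →+* ℂ) p
    change (MvPolynomial.aeval κ p) x = _ at h3
    exact h3
  have hsep : A.SeparatesPoints := by
    intro x y hxy
    by_contra hne
    apply hxy
    have hc : ∀ c, planeCoord c (x : EuclideanSpace ℝ (Fin 2 × Fin n)) = planeCoord c y :=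
      fun c => by
        by_contra hc
        exact hne ⟨κ c, ⟨κ c, StarAlgebra.subset_adjoin ℂ _ ⟨c, rfl⟩, rfl⟩, hc⟩
    ext ⟨a, j⟩
    have h0 := hc (0, j)
    simp only [planeCoord_apply] at h0
    have hre := congrArg Complex.re h0
    have him := congrArg Complex.im h0
    fin_cases a
    · simpa using hre
    · simpa using him
  have hdense := ContinuousMap.starSubalgebra_topologicalClosure_eq_top_of_separatesPoints A hsep
  obtain ⟨C, hC⟩ := exists_norm_sphereIntegral_le (E := EuclideanSpace ℝ (Fin 2 × Fin n))
  let fc : C(S, ℂ) := ⟨f, hf⟩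
  refine eq_zero_of_sphereIntegral_conj_mul_self hf ?_ x
  have hstar : star fc ∈ closure (A : Set C(S, ℂ)) := by
    rw [← StarSubalgebra.topologicalClosure_coe, hdense]
    trivial
  -- Orthogonality to g gives ∫ f conj f = ∫ f (conj f - g), which is small once g is uniformly
  -- close to conj f.
  have hbound : ∀ g ∈ A, ‖sphereIntegral (fun x => f x * (starRingEnd ℂ) (f x))‖ ≤
      C * (‖fc‖ * ‖star fc - g‖) := fun g hg => by
    obtain ⟨p, hp⟩ := hA g hg
    have h1 : sphereIntegral (fun x => f x * (starRingEnd ℂ) (f x)) =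
        sphereIntegral (fun x => f x * (star fc - g) x) := by
      have h2 := sphereIntegral_add (f := fun x => f x * (star fc - g) x)
        (g := fun x => f x * polyFun p x) (hf.mul (star fc - g).continuous)
        (hf.mul (continuous_polyFun_sphere p))
      rw [h p, add_zero] at h2
      rw [← h2]
      congr 1
      funext x
      rw [← hp x]
      simp [fc]
      ring
    rw [h1]
    refine hC _ _ fun x => ?_
    rw [norm_mul]
    exact mul_le_mul (fc.norm_coe_le_norm x) ((star fc - g).norm_coe_le_norm x) (norm_nonneg _)
      (norm_nonneg _)
  obtain ⟨u, hu, hlim⟩ := mem_closure_iff_seq_limit.1 hstar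
  have h0 : Filter.Tendsto (fun i => C * (‖fc‖ * ‖star fc - u i‖)) Filter.atTop (nhds 0) := by
    have := ((tendsto_const_nhds (x := star fc)).sub hlim).norm.const_mul ‖fc‖ |>.const_mul C
    simpa using this
  have h1 := ge_of_tendsto h0 (Filter.Eventually.of_forall fun i => hbound (u i) (hu i))
  exact norm_le_zero_iff.1 h1

end Polynomials

/-! ### The action of γ on monomials and the invariant polynomials. -/

namespace LensParams

variable (P : LensParams)

theorem gamma_smul_coe (x : P.Sphere) :
    ((P.gamma • x : P.Sphere) : P.Ambient) = WithLp.toLp 2 (P.gammaMatrix.mulVec x.1.ofLp) := rfl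

/-- The isometry of the ambient space that `γ` defines. -/
def gammaIsometry : P.Ambient ≃ₗᵢ[ℝ] P.Ambient :=
  LinearIsometry.toLinearIsometryEquiv
    { toFun := fun x => WithLp.toLp 2 (P.gammaMatrix.mulVec x.ofLp)
      map_add' := fun x y => by simp [Matrix.mulVec_add]
      map_smul' := fun c x => by simp [Matrix.mulVec_smul]
      norm_map' := fun x => by
        by_cases hx : x = 0
        · simp [hx]
        obtain ⟨y, hy⟩ := exists_sphere_eq hx
        have h1 : ‖((P.gamma • y : P.Sphere) : P.Ambient)‖ = 1 := by simp
        have hx' : x = ‖x‖ • (y : P.Ambient) := by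
          rw [hy, smul_smul, mul_inv_cancel₀ (norm_ne_zero_iff.2 hx), one_smul]
        have h2 : WithLp.toLp 2 (P.gammaMatrix.mulVec x.ofLp) =
            ‖x‖ • ((P.gamma • y : P.Sphere) : P.Ambient) := by
          conv_lhs => rw [hx']
          rw [gamma_smul_coe]
          simp [Matrix.mulVec_smul]
        change ‖WithLp.toLp 2 (P.gammaMatrix.mulVec x.ofLp)‖ = ‖x‖
        rw [h2, norm_smul, h1]
        simp } rfl

theorem sphereIntegral_comp_gamma (f : P.Sphere → ℂ) :
    sphereIntegral (fun x => f (P.gamma • x)) = sphereIntegral f :=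
  sphereIntegral_comp_isometry P.gammaIsometry (fun _ => rfl) f

/-- The angle by which `γ` rotates the coordinate with index `c`. -/
def coordAngle (c : Fin 2 × Fin P.n) : ℤ := if c.1 = 0 then -P.s c.2 else P.s c.2

/-- The j-th block sends z_j to exp(-2πi s_j/q) z_j, which explains the signs in `coordAngle`. -/
theorem planeCoord_gamma (c : Fin 2 × Fin P.n) (x : P.Sphere) :
    planeCoord c ((P.gamma • x : P.Sphere) : P.Ambient) =
      Complex.exp (P.coordAngle c * (2 * Real.pi * Complex.I / P.q)) *
        planeCoord c (x : P.Ambient) := by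
  obtain ⟨a, j⟩ := c
  have h0 : ∀ a, ((P.gamma • x : P.Sphere) : P.Ambient) (a, j) =
      ∑ b, (!![Real.cos (2 * Real.pi * P.s j / P.q), Real.sin (2 * Real.pi * P.s j / P.q);
        -Real.sin (2 * Real.pi * P.s j / P.q), Real.cos (2 * Real.pi * P.s j / P.q)] :
        Matrix (Fin 2) (Fin 2) ℝ) a b * (x : P.Ambient) (b, j) := fun a => by
    rw [gamma_smul_coe]
    simp only [Matrix.mulVec, dotProduct, gammaMatrix, Fintype.sum_prod_type]
    refine Finset.sum_congr rfl fun b _ => ?_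
    rw [Finset.sum_eq_single j]
    · rw [Matrix.blockDiagonal_apply_eq]
    · intro i _ hi
      rw [Matrix.blockDiagonal_apply_ne _ _ _ hi.symm, zero_mul]
    · simp
  have e0 := h0 0
  have e1 := h0 1
  simp only [Fin.sum_univ_two, Matrix.of_apply, Matrix.cons_val_zero, Matrix.cons_val_one]
    at e0 e1
  have hpos : Complex.exp (P.s j * (2 * Real.pi * Complex.I / P.q)) =
      (Real.cos (2 * Real.pi * P.s j / P.q) : ℂ) +
        (Real.sin (2 * Real.pi * P.s j / P.q) : ℂ) * Complex.I := by
    rw [Complex.ofReal_cos, Complex.ofReal_sin, ← Complex.exp_mul_I]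
    congr 1
    push_cast
    ring
  have hneg : Complex.exp ((-P.s j : ℤ) * (2 * Real.pi * Complex.I / P.q)) =
      (Real.cos (2 * Real.pi * P.s j / P.q) : ℂ) +
        -(Real.sin (2 * Real.pi * P.s j / P.q) : ℂ) * Complex.I := by
    rw [Complex.ofReal_cos, Complex.ofReal_sin, ← Complex.sin_neg, ← Complex.cos_neg,
      ← Complex.exp_mul_I]
    congr 1
    push_cast
    ring
  generalize Real.cos (2 * Real.pi * P.s j / P.q) = C at *
  generalize Real.sin (2 * Real.pi * P.s j / P.q) = S at *
  obtain rfl | rfl : a = 0 ∨ a = 1 := by fin_cases a <;> simp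
  · rw [show P.coordAngle (0, j) = -P.s j from rfl, hneg, planeCoord_apply, planeCoord_apply]
    simp only [e0, e1, if_true]
    push_cast
    linear_combination ((S : ℂ) * ((x : P.Ambient) (1, j) : ℂ)) * Complex.I_sq
  · rw [show P.coordAngle (1, j) = P.s j from rfl, hpos, planeCoord_apply, planeCoord_apply]
    simp only [e0, e1, one_ne_zero, if_false]
    push_cast
    linear_combination ((S : ℂ) * ((x : P.Ambient) (1, j) : ℂ)) * Complex.I_sq

/-- The weight of a monomial with respect to `γ`. -/
def charge (e : Fin 2 × Fin P.n →₀ ℕ) : ℤ := ∑ c, e c * P.coordAngle c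

theorem polyFun_monomial_gamma (e : Fin 2 × Fin P.n →₀ ℕ) (a : ℂ) (x : P.Sphere) :
    polyFun (MvPolynomial.monomial e a) ((P.gamma • x : P.Sphere) : P.Ambient) =
      Complex.exp (P.charge e * (2 * Real.pi * Complex.I / P.q)) *
        polyFun (MvPolynomial.monomial e a) (x : P.Ambient) := by
  have h : Complex.exp (P.charge e * (2 * Real.pi * Complex.I / P.q)) =
      ∏ c, Complex.exp (P.coordAngle c * (2 * Real.pi * Complex.I / P.q)) ^ e c := by
    simp only [← Complex.exp_nat_mul]
    rw [← Complex.exp_sum, charge]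
    push_cast
    rw [Finset.sum_mul]
    simp only [mul_assoc]
  have hp : ∀ y : P.Ambient, polyFun (MvPolynomial.monomial e a) y =
      a * ∏ c, planeCoord c y ^ e c := fun y => by
    rw [polyFun, MvPolynomial.eval_monomial, Finsupp.prod_fintype _ _ fun _ => pow_zero _]
  rw [hp, hp, h]
  simp only [planeCoord_gamma, mul_pow, Finset.prod_mul_distrib]
  ring

theorem exp_charge_eq_one_iff (t : ℤ) :
    Complex.exp (t * (2 * Real.pi * Complex.I / P.q)) = 1 ↔ (P.q : ℤ) ∣ t := by
  have hq : (P.q : ℂ) ≠ 0 := Nat.cast_ne_zero.2 P.q_pos.ne'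
  rw [Complex.exp_eq_one_iff]
  constructor
  · rintro ⟨k, hk⟩
    refine ⟨k, ?_⟩
    have h2 : (2 * Real.pi * Complex.I : ℂ) ≠ 0 := Complex.two_pi_I_ne_zero
    have h3 : (t : ℂ) * (2 * Real.pi * Complex.I) = (P.q * k) * (2 * Real.pi * Complex.I) := by
      field_simp at hk
      linear_combination (2 * Real.pi * Complex.I) * hk
    exact_mod_cast mul_right_cancel₀ h2 h3
  · rintro ⟨k, rfl⟩
    refine ⟨k, ?_⟩
    push_cast
    field_simp

/-- The exponents of the `γ`-invariant monomials of degree `k - c`. -/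
def expSet (k c : ℕ) : Set (Fin 2 × Fin P.n →₀ ℕ) :=
  {e | e.degree + c = k ∧ (P.q : ℤ) ∣ P.charge e}

theorem finite_expSet (k c : ℕ) : (P.expSet k c).Finite :=
  (Finsupp.finite_of_degree_le k).subset fun e he => by
    have := he.1
    change e.degree ≤ k
    omega

/-- The space of `γ`-invariant homogeneous polynomials of degree `k - c`. -/
def polySpace (k c : ℕ) : Submodule ℂ (MvPolynomial (Fin 2 × Fin P.n) ℂ) :=
  MvPolynomial.restrictSupport ℂ (P.expSet k c)

instance (k c : ℕ) : FiniteDimensional ℂ (P.polySpace k c) :=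
  have := (P.finite_expSet k c).to_subtype
  Module.Finite.of_basis (MvPolynomial.basisRestrictSupport ℂ (P.expSet k c))

theorem finrank_polySpace (k c : ℕ) :
    Module.finrank ℂ (P.polySpace k c) = (P.expSet k c).ncard :=
  Module.finrank_eq_nat_card_basis (MvPolynomial.basisRestrictSupport ℂ (P.expSet k c))

theorem polySpace_induction {k c : ℕ} {W : Submodule ℂ (MvPolynomial (Fin 2 × Fin P.n) ℂ)}
    (h : ∀ e ∈ P.expSet k c, MvPolynomial.monomial e 1 ∈ W) : P.polySpace k c ≤ W := by
  rw [polySpace, MvPolynomial.restrictSupport_eq_span, Submodule.span_le]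
  rintro _ ⟨e, he, rfl⟩
  exact h e he

theorem isHomogeneous_of_mem_polySpace {k : ℕ} {p : MvPolynomial (Fin 2 × Fin P.n) ℂ}
    (hp : p ∈ P.polySpace k 0) : p.IsHomogeneous k := by
  refine P.polySpace_induction (W := MvPolynomial.homogeneousSubmodule _ ℂ k) (fun e he => ?_) hp
  exact MvPolynomial.isHomogeneous_monomial 1 he.1

theorem polyFun_gamma_of_mem_polySpace {k c : ℕ} {p : MvPolynomial (Fin 2 × Fin P.n) ℂ}
    (hp : p ∈ P.polySpace k c) (x : P.Sphere) :
    polyFun p ((P.gamma • x : P.Sphere) : P.Ambient) = polyFun p (x : P.Ambient) := by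
  refine P.polySpace_induction (k := k) (c := c) (W :=
    { carrier := {p | polyFun p ((P.gamma • x : P.Sphere) : P.Ambient) = polyFun p (x : P.Ambient)}
      add_mem' := fun {p q} (hp : _ = _) (hq : _ = _) => ?_
      zero_mem' := rfl
      smul_mem' := fun c p (hp : _ = _) => ?_ }) (fun e he => ?_) hp
  · simp only [polyFun] at hp hq
    simp [polyFun, hp, hq]
  · simp only [polyFun] at hp
    simp [polyFun, MvPolynomial.smul_eval, hp]
  · change polyFun _ _ = polyFun _ _
    rw [polyFun_monomial_gamma, (P.exp_charge_eq_one_iff _).2 he.2, one_mul]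

theorem charge_add (e e' : Fin 2 × Fin P.n →₀ ℕ) :
    P.charge (e + e') = P.charge e + P.charge e' := by
  simp only [charge, ← Finset.sum_add_distrib]
  refine Finset.sum_congr rfl fun c _ => ?_
  push_cast [Finsupp.add_apply]
  ring

theorem charge_single_add_single (j : Fin P.n) :
    P.charge (Finsupp.single ((0 : Fin 2), j) 1 + Finsupp.single ((1 : Fin 2), j) 1) = 0 := by
  have h : ∀ c, P.charge (Finsupp.single c 1) = P.coordAngle c := fun c => by
    rw [charge, Finset.sum_eq_single c] <;> simp +contextual [eq_comm]
  rw [charge_add, h, h]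
  simp [coordAngle]

/-- The product z_j conj z_j is invariant of degree 2. Both multiplication by |z|² and the Laplacian
shift exponents in this way, so they preserve invariance. -/
theorem add_single_mem_expSet {k : ℕ} {e : Fin 2 × Fin P.n →₀ ℕ} (j : Fin P.n) :
    e + (Finsupp.single ((0 : Fin 2), j) 1 + Finsupp.single ((1 : Fin 2), j) 1) ∈ P.expSet k 0 ↔
      e ∈ P.expSet k 2 := by
  simp only [expSet, Set.mem_ofPred_eq, charge_add P e, charge_single_add_single, add_zero,
    map_add, Finsupp.degree_single]

theorem formalLaplacian_mem_polySpace {k : ℕ} {p : MvPolynomial (Fin 2 × Fin P.n) ℂ}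
    (hp : p ∈ P.polySpace k 0) : formalLaplacian P.n p ∈ P.polySpace k 2 := by
  refine P.polySpace_induction (W := (P.polySpace k 2).comap (formalLaplacian P.n))
    (fun e he => ?_) hp
  simp only [Submodule.mem_comap, formalLaplacian, LinearMap.sum_apply, LinearMap.comp_apply]
  refine Submodule.sum_mem _ fun j _ => ?_
  change MvPolynomial.pderiv _ (MvPolynomial.pderiv _ _) ∈ _
  rw [MvPolynomial.pderiv_monomial, MvPolynomial.pderiv_monomial, polySpace,
    MvPolynomial.monomial_mem_restrictSupport]
  -- If a variable to be differentiated is absent the coefficient is 0; otherwise the truncated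
  -- subtractions of exponents are genuine.
  by_cases h1 : e ((1 : Fin 2), j) = 0
  · right; simp [h1]
  by_cases h0 : e ((0 : Fin 2), j) = 0
  · right; simp [h0]
  left
  rw [← P.add_single_mem_expSet j]
  convert he using 1
  ext c
  by_cases hc0 : c = (0, j)
  · subst hc0; simp; omega
  by_cases hc1 : c = (1, j)
  · subst hc1; simp; omega
  simp [Ne.symm hc0, Ne.symm hc1]

theorem normSqPoly_mul_mem_polySpace {k : ℕ} {p : MvPolynomial (Fin 2 × Fin P.n) ℂ}
    (hp : p ∈ P.polySpace k 2) : normSqPoly P.n * p ∈ P.polySpace k 0 := by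
  refine P.polySpace_induction
    (W := (P.polySpace k 0).comap (LinearMap.mulLeft ℂ (normSqPoly P.n))) (fun e he => ?_) hp
  simp only [Submodule.mem_comap, LinearMap.mulLeft_apply, normSqPoly, Finset.sum_mul]
  refine Submodule.sum_mem _ fun j _ => ?_
  rw [MvPolynomial.X, MvPolynomial.X, MvPolynomial.monomial_mul, MvPolynomial.monomial_mul,
    polySpace, MvPolynomial.monomial_mem_restrictSupport, add_comm _ e]
  exact Or.inl ((P.add_single_mem_expSet j).2 he)

end LensParams

/-- The `k`-th eigenvalue `k (k + 2n - 2)` of the Laplacian of the sphere `S^{2n-1}`. -/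
def sphericalEigenvalue (n k : ℕ) : ℂ := k * (k + ((2 * n - 1 : ℕ) : ℂ) - 1)

theorem sphericalEigenvalue_eq_natCast {n : ℕ} (hn : 1 ≤ n) (k : ℕ) :
    sphericalEigenvalue n k = ((k * (k + 2 * (n - 1)) : ℕ) : ℂ) := by
  obtain ⟨m, rfl⟩ := Nat.exists_eq_add_of_le' hn
  rw [sphericalEigenvalue, show 2 * (m + 1) - 1 = 2 * m + 1 by omega, Nat.add_sub_cancel]
  push_cast
  ring

theorem sphericalEigenvalue_injective {n : ℕ} (hn : 1 ≤ n) :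
    Function.Injective (sphericalEigenvalue n) := by
  intro k l h
  rw [sphericalEigenvalue_eq_natCast hn, sphericalEigenvalue_eq_natCast hn, Nat.cast_inj] at h
  have hm : StrictMono fun k : ℕ => k * (k + 2 * (n - 1)) := fun a b hab =>
    Nat.mul_lt_mul_of_lt_of_le hab (by omega) (by omega)
  exact hm.injective h

/-! ### Multiplicities of the eigenvalues. -/

namespace LensParams

variable (P : LensParams)

theorem comp_proj_gamma (f : P.LensSpace → ℂ) (x : P.Sphere) :
    f (P.proj (P.gamma • x)) = f (P.proj x) := by
  congr 1
  exact Quotient.sound ⟨⟨P.gamma, Subgroup.mem_zpowers _⟩, rfl⟩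

/-- The group elements preserving g form a subgroup containing γ. This lets invariant functions
descend through arbitrary orbit representatives. -/
theorem apply_out_proj {g : P.Sphere → ℂ} (hg : ∀ x, g (P.gamma • x) = g x) (x : P.Sphere) :
    g (Quotient.out (P.proj x)) = g x := by
  let H : Subgroup (Matrix.orthogonalGroup (Fin 2 × Fin P.n) ℝ) :=
    { carrier := {h | ∀ x, g (h • x) = g x}
      mul_mem' := fun {a b} ha hb x => by rw [mul_smul, ha, hb]
      one_mem' := fun x => by rw [one_smul]
      inv_mem' := fun {a} ha x => by
        have := ha (a⁻¹ • x)
        rw [smul_inv_smul] at this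
        exact this.symm }
  have hH : Subgroup.zpowers P.gamma ≤ H := by
    rw [Subgroup.zpowers_le]
    exact hg
  obtain ⟨⟨h, hh⟩, hx⟩ := Quotient.mk_out
    (s := MulAction.orbitRel (Subgroup.zpowers P.gamma) P.Sphere) x
  have h1 : h • x = Quotient.out (P.proj x) := hx
  rw [← h1]
  exact hH hh x

variable {P} in
theorem mem_eigenspace_iff {μ : ℂ} {f : P.LensSpace → ℂ} :
    f ∈ P.eigenspace μ ↔ P.IsSmooth f ∧ P.IsLaplacian f (fun p => μ * f p) := Iff.rfl

variable {P} in
theorem continuous_of_mem_eigenspace {μ : ℂ} {f : P.LensSpace → ℂ} (hf : f ∈ P.eigenspace μ) :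
    Continuous fun x : P.Sphere => f (P.proj x) :=
  ContMDiff.continuous hf.1

variable {P} in
theorem continuous_eigenfunction_mul {μ : ℂ} {f : P.LensSpace → ℂ} (hf : f ∈ P.eigenspace μ)
    (p : MvPolynomial (Fin 2 × Fin P.n) ℂ) :
    Continuous fun x : P.Sphere => f (P.proj x) * polyFun p x :=
  (continuous_of_mem_eigenspace hf).mul (continuous_polyFun_sphere p)

theorem mem_polySpace_sub_two {k : ℕ} (hk : 2 ≤ k) {p : MvPolynomial (Fin 2 × Fin P.n) ℂ}
    (hp : p ∈ P.polySpace k 2) : p ∈ P.polySpace (k - 2) 0 := by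
  refine MvPolynomial.restrictSupport_mono ℂ (s := P.expSet k 2) ?_ hp
  rintro e ⟨h1, h2⟩
  exact ⟨by omega, h2⟩

/-- `expSet k c` requires `degree + c = k` instead of using truncated subtraction, so it is empty
here; this ends the descent by steps of 2. -/
theorem eq_zero_of_mem_polySpace {k : ℕ} (hk : k < 2) {p : MvPolynomial (Fin 2 × Fin P.n) ℂ}
    (hp : p ∈ P.polySpace k 2) : p = 0 := by
  refine P.polySpace_induction (W := ⊥) (fun e he => ?_) hp
  have := he.1
  omega

variable {P} in
/-- The pairing of an eigenfunction with a homogeneous polynomial. -/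
theorem sphereIntegral_eigenfunction_mul {μ : ℂ} {f : P.LensSpace → ℂ}
    (hf : f ∈ P.eigenspace μ) {k : ℕ} {p : MvPolynomial (Fin 2 × Fin P.n) ℂ}
    (hp : p.IsHomogeneous k) :
    (μ - sphericalEigenvalue P.n k) * sphereIntegral (fun x => f (P.proj x) * polyFun p x) +
      4 * sphereIntegral (fun x => f (P.proj x) * polyFun (formalLaplacian P.n p) x) = 0 := by
  have h := sphereIntegral_laplaceBeltrami_symm hf.1
    (contMDiff_polyFun_sphere (m := 2 * P.n - 1) p)
  have hc : ∀ (c : ℂ) (p : MvPolynomial (Fin 2 × Fin P.n) ℂ),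
      Continuous fun x : P.Sphere => c * (f (P.proj x) * polyFun p x) := fun c p => by
    have h := continuous_eigenfunction_mul hf p
    exact (continuous_const (y := c)).mul h
  rw [← h, ← sphereIntegral_const_mul, ← sphereIntegral_const_mul,
    ← sphereIntegral_add (hc _ p) (hc 4 _)]
  congr 1
  funext x
  rw [laplaceBeltrami_polyFun hp, ← hf.2 x, sphericalEigenvalue]
  ring

variable {P} in
-- When μ ≠ λ_k the previous identity expresses the pairing with p through the pairing with its
-- Laplacian, of degree k - 2. The descent stops only at a degree j with λ_j = μ, where vanishing is
-- assumed.
theorem sphereIntegral_eigenfunction_mul_eq_zero {μ : ℂ} {f : P.LensSpace → ℂ}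
    (hf : f ∈ P.eigenspace μ) (k : ℕ)
    (h : ∀ j ≤ k, μ = sphericalEigenvalue P.n j → ∀ p ∈ P.polySpace j 0,
      sphereIntegral (fun x => f (P.proj x) * polyFun p x) = 0) :
    ∀ p ∈ P.polySpace k 0, sphereIntegral (fun x => f (P.proj x) * polyFun p x) = 0 := by
  induction k using Nat.strong_induction_on with
  | _ k ih =>
    intro p hp
    by_cases hμ : μ = sphericalEigenvalue P.n k
    · exact h k le_rfl hμ p hp
    have h1 := sphereIntegral_eigenfunction_mul hf (P.isHomogeneous_of_mem_polySpace hp)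
    have h2 : sphereIntegral (fun x => f (P.proj x) * polyFun (formalLaplacian P.n p) x) = 0 := by
      have hD := P.formalLaplacian_mem_polySpace hp
      by_cases hk : 2 ≤ k
      · exact ih (k - 2) (by omega) (fun j hj => h j (by omega)) _ (P.mem_polySpace_sub_two hk hD)
      · rw [P.eq_zero_of_mem_polySpace (by omega) hD]
        simpa [polyFun] using sphereIntegral_const_mul (E := P.Ambient) 0 fun _ => 0
    rw [h2, mul_zero, add_zero, mul_eq_zero, sub_eq_zero] at h1
    exact h1.resolve_left hμ

variable {P} in
/-- An eigenfunction that is orthogonal to all invariant homogeneous polynomials vanishes. -/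
theorem eq_zero_of_mem_eigenspace {μ : ℂ} {f : P.LensSpace → ℂ} (hf : f ∈ P.eigenspace μ)
    (h : ∀ k, ∀ p ∈ P.polySpace k 0, sphereIntegral (fun x => f (P.proj x) * polyFun p x) = 0) :
    f = 0 := by
  have hc := continuous_of_mem_eigenspace hf
  have hmono : ∀ (e : Fin 2 × Fin P.n →₀ ℕ) (a : ℂ),
      sphereIntegral (fun x => f (P.proj x) * polyFun (MvPolynomial.monomial e a) x) = 0 :=
    fun e a => by
      by_cases he : (P.q : ℤ) ∣ P.charge e
      · refine h e.degree _ ?_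
        rw [polySpace, MvPolynomial.monomial_mem_restrictSupport]
        exact Or.inl ⟨rfl, he⟩
      -- Invariance of the integral under γ multiplies this pairing by a number other than 1, so a
      -- non-invariant monomial is automatically orthogonal to f.
      · have h1 := P.sphereIntegral_comp_gamma
          (fun x => f (P.proj x) * polyFun (MvPolynomial.monomial e a) x)
        simp only [comp_proj_gamma, polyFun_monomial_gamma, mul_left_comm (f _),
          sphereIntegral_const_mul] at h1
        rw [← sub_eq_zero, ← sub_one_mul, mul_eq_zero, sub_eq_zero, exp_charge_eq_one_iff] at h1
        exact h1.resolve_left he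
  have hall : ∀ p : MvPolynomial (Fin 2 × Fin P.n) ℂ,
      sphereIntegral (fun x => f (P.proj x) * polyFun p x) = 0 := fun p => by
    induction p using MvPolynomial.monomial_add_induction_on with
    | C a => exact hmono 0 a
    | monomial_add e a p _ _ ih =>
      have h1 := sphereIntegral_add
        (continuous_eigenfunction_mul hf (MvPolynomial.monomial e a))
        (continuous_eigenfunction_mul hf p)
      rw [hmono, ih, add_zero] at h1
      rw [← h1]
      congr 1
      funext x
      simp [polyFun, mul_add]
  funext ℓ
  induction ℓ using Quotient.inductionOn with
  | _ x => exact eq_zero_of_sphereIntegral_mul_polyFun hc hall x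

theorem rank_eigenspace_eq_zero {μ : ℂ} (hμ : ∀ k, μ ≠ sphericalEigenvalue P.n k) :
    Module.rank ℂ (P.eigenspace μ) = 0 := by
  have h : P.eigenspace μ = ⊥ := by
    rw [Submodule.eq_bot_iff]
    exact fun f hf => eq_zero_of_mem_eigenspace hf fun k =>
      sphereIntegral_eigenfunction_mul_eq_zero hf k fun j _ hj => absurd hj (hμ j)
  rw [h, rank_bot]

/-- The pairing of eigenfunctions with invariant polynomials. -/
def eigenspacePairing (μ : ℂ) (k : ℕ) :
    P.eigenspace μ →ₗ[ℂ] Module.Dual ℂ (P.polySpace k 0) :=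
  LinearMap.mk₂ ℂ (fun f p => sphereIntegral fun x => f.1 (P.proj x) * polyFun p.1 x)
    (fun f g p => by
      rw [← sphereIntegral_add
        (continuous_eigenfunction_mul f.2 _)
        (continuous_eigenfunction_mul g.2 _)]
      congr 1
      funext x
      exact add_mul _ _ _)
    (fun c f p => by
      rw [smul_eq_mul, ← sphereIntegral_const_mul]
      congr 1
      funext x
      exact mul_assoc _ _ _)
    (fun f p q => by
      rw [← sphereIntegral_add
        (continuous_eigenfunction_mul f.2 _)
        (continuous_eigenfunction_mul f.2 _)]
      congr 1
      funext x
      simp [polyFun, mul_add])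
    (fun c f p => by
      rw [smul_eq_mul, ← sphereIntegral_const_mul]
      congr 1
      funext x
      simp [polyFun, MvPolynomial.smul_eval]
      ring)

/-- Multiplication by the squared norm. -/
def mulNormSq (k : ℕ) : P.polySpace k 2 →ₗ[ℂ] P.polySpace k 0 :=
  ((LinearMap.mulLeft ℂ (normSqPoly P.n)).comp (P.polySpace k 2).subtype).codRestrict _
    fun p => P.normSqPoly_mul_mem_polySpace p.2

theorem normSqPoly_ne_zero : normSqPoly P.n ≠ 0 := by
  intro h
  have hn := P.two_le_n
  have h1 := polyFun_normSqPoly (EuclideanSpace.single ((0 : Fin 2), (⟨0, by omega⟩ : Fin P.n)) 1)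
  rw [h] at h1
  simp [polyFun] at h1

theorem mulNormSq_injective (k : ℕ) : Function.Injective (P.mulNormSq k) := by
  intro p q h
  exact Subtype.ext (mul_left_cancel₀ P.normSqPoly_ne_zero (congrArg Subtype.val h))

/-- Since the λ_j are distinct, degree k is the only obstruction in the descent: trivial pairing
there forces orthogonality to every invariant polynomial. -/
theorem eigenspacePairing_injective (k : ℕ) :
    Function.Injective (P.eigenspacePairing (sphericalEigenvalue P.n k) k) := by
  rw [← LinearMap.ker_eq_bot, LinearMap.ker_eq_bot']
  intro f hf
  refine Subtype.ext (eq_zero_of_mem_eigenspace f.2 fun l =>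
    sphereIntegral_eigenfunction_mul_eq_zero f.2 l fun j _ hj p hp => ?_)
  have hn := P.two_le_n
  obtain rfl := sphericalEigenvalue_injective (by omega) hj
  exact congrArg (fun T => T ⟨p, hp⟩) hf

/-- On the sphere |z|² = 1, so pairing with |z|² p is pairing with p, of degree k - 2; the descent
from there never meets λ_k. -/
theorem eigenspacePairing_mem_dualAnnihilator (k : ℕ)
    (f : P.eigenspace (sphericalEigenvalue P.n k)) :
    P.eigenspacePairing (sphericalEigenvalue P.n k) k f ∈
      (LinearMap.range (P.mulNormSq k)).dualAnnihilator := by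
  rw [Submodule.mem_dualAnnihilator]
  rintro _ ⟨p, rfl⟩
  have h1 : P.eigenspacePairing (sphericalEigenvalue P.n k) k f (P.mulNormSq k p) =
      sphereIntegral fun x => f.1 (P.proj x) * polyFun p.1 x := by
    change sphereIntegral (fun x => f.1 (P.proj x) * polyFun (normSqPoly P.n * p.1) x) = _
    congr 1
    funext x
    rw [polyFun_mul, polyFun_normSqPoly]
    simp
  rw [h1]
  have hn := P.two_le_n
  by_cases hk : 2 ≤ k
  · refine sphereIntegral_eigenfunction_mul_eq_zero f.2 (k - 2) (fun j hj hj' => ?_) _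
      (P.mem_polySpace_sub_two hk p.2)
    obtain rfl := sphericalEigenvalue_injective (by omega) hj'
    omega
  · rw [P.eq_zero_of_mem_polySpace (by omega) p.2]
    simpa [polyFun] using sphereIntegral_const_mul (E := P.Ambient) 0 fun _ => 0

instance finiteDimensional_eigenspace (k : ℕ) :
    FiniteDimensional ℂ (P.eigenspace (sphericalEigenvalue P.n k)) :=
  FiniteDimensional.of_injective _ (P.eigenspacePairing_injective k)

theorem finrank_eigenspace_add_le (k : ℕ) :
    Module.finrank ℂ (P.eigenspace (sphericalEigenvalue P.n k)) + (P.expSet k 2).ncard ≤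
      (P.expSet k 0).ncard := by
  have h1 : Module.finrank ℂ (P.eigenspace (sphericalEigenvalue P.n k)) ≤
      Module.finrank ℂ (LinearMap.range (P.mulNormSq k)).dualAnnihilator :=
    LinearMap.finrank_le_finrank_of_injective
      (f := (P.eigenspacePairing (sphericalEigenvalue P.n k) k).codRestrict _
        (P.eigenspacePairing_mem_dualAnnihilator k)) fun f g h =>
      P.eigenspacePairing_injective k (congrArg Subtype.val h)
  have h2 := Subspace.finrank_add_finrank_dualAnnihilator_eq (LinearMap.range (P.mulNormSq k))
  rw [LinearMap.finrank_range_of_inj (P.mulNormSq_injective k), finrank_polySpace,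
    finrank_polySpace] at h2
  omega

/-- The formal Laplacian on invariant homogeneous polynomials. -/
def laplacianPoly (k : ℕ) : P.polySpace k 0 →ₗ[ℂ] P.polySpace k 2 :=
  ((formalLaplacian P.n).comp (P.polySpace k 0).subtype).codRestrict _
    fun p => P.formalLaplacian_mem_polySpace p.2

theorem polyFun_out_mem_eigenspace {k : ℕ} {p : MvPolynomial (Fin 2 × Fin P.n) ℂ}
    (hp : p ∈ P.polySpace k 0) (hD : formalLaplacian P.n p = 0) :
    (fun ℓ : P.LensSpace => polyFun p ((Quotient.out ℓ : P.Sphere) : P.Ambient)) ∈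
      P.eigenspace (sphericalEigenvalue P.n k) := by
  have h : ∀ x : P.Sphere, polyFun p ((Quotient.out (P.proj x) : P.Sphere) : P.Ambient) =
      polyFun p (x : P.Ambient) :=
    P.apply_out_proj (g := fun x => polyFun p (x : P.Ambient))
      (P.polyFun_gamma_of_mem_polySpace hp)
  rw [mem_eigenspace_iff]
  simp only [IsSmooth, IsLaplacian, h]
  refine ⟨contMDiff_polyFun_sphere p, fun x => ?_⟩
  rw [laplaceBeltrami_polyFun (P.isHomogeneous_of_mem_polySpace hp), hD, sphericalEigenvalue]
  simp [polyFun]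

/-- Restriction of harmonic polynomials to the sphere. -/
def harmonicToEigenspace (k : ℕ) :
    LinearMap.ker (P.laplacianPoly k) →ₗ[ℂ] P.eigenspace (sphericalEigenvalue P.n k) where
  toFun p := ⟨_, P.polyFun_out_mem_eigenspace p.1.2 (congrArg Subtype.val p.2)⟩
  map_add' p q := Subtype.ext (funext fun ℓ => by simp [polyFun])
  map_smul' c p := Subtype.ext (funext fun ℓ => by simp [polyFun, MvPolynomial.smul_eval])

/-- A homogeneous polynomial vanishing on the sphere vanishes on every ray, hence is zero. -/
theorem harmonicToEigenspace_injective (k : ℕ) :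
    Function.Injective (P.harmonicToEigenspace k) := by
  refine (injective_iff_map_eq_zero _).2 fun p hp => ?_
  have hom := P.isHomogeneous_of_mem_polySpace p.1.2
  have hS : ∀ x : P.Sphere, polyFun p.1.1 (x : P.Ambient) = 0 := fun x => by
    rw [← P.apply_out_proj (g := fun x => polyFun p.1.1 (x : P.Ambient))
      (P.polyFun_gamma_of_mem_polySpace p.1.2) x]
    exact congrFun (congrArg Subtype.val hp) (P.proj x)
  have hn := P.two_le_n
  have hne : (EuclideanSpace.single ((0 : Fin 2), (⟨0, by omega⟩ : Fin P.n)) (1 : ℝ)) ≠ 0 := by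
    simp
  refine Subtype.ext (Subtype.ext (eq_zero_of_polyFun_eq_zero fun x => ?_))
  have key : ∀ (t : ℝ) (y : P.Sphere), polyFun p.1.1 (t • (y : P.Ambient)) = 0 := fun t y => by
    rw [polyFun_smul_of_isHomogeneous hom, hS, mul_zero]
  by_cases hx : x = 0
  · obtain ⟨y, -⟩ := exists_sphere_eq hne
    have := key 0 y
    rwa [zero_smul, ← hx] at this
  · obtain ⟨y, hy⟩ := exists_sphere_eq hx
    have := key ‖x‖ y
    rwa [hy, smul_smul, mul_inv_cancel₀ (norm_ne_zero_iff.2 hx), one_smul] at this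

/-- Rank-nullity for the formal Laplacian, with its rank bounded only by the dimension of the
target. -/
theorem le_finrank_eigenspace_add (k : ℕ) :
    (P.expSet k 0).ncard ≤
      Module.finrank ℂ (P.eigenspace (sphericalEigenvalue P.n k)) + (P.expSet k 2).ncard := by
  have h1 := LinearMap.finrank_le_finrank_of_injective (P.harmonicToEigenspace_injective k)
  have h2 := LinearMap.finrank_range_add_finrank_ker (P.laplacianPoly k)
  have h3 := Submodule.finrank_le (LinearMap.range (P.laplacianPoly k))
  rw [finrank_polySpace] at h2 h3
  omega

theorem finrank_eigenspace_add (k : ℕ) :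
    Module.finrank ℂ (P.eigenspace (sphericalEigenvalue P.n k)) + (P.expSet k 2).ncard =
      (P.expSet k 0).ncard :=
  le_antisymm (P.finrank_eigenspace_add_le k) (P.le_finrank_eigenspace_add k)

end LensParams

/-! ### Counting invariant monomials by lattice vectors. -/

theorem ncard_eq_sum_ncard_fiber {α : Type*} {S : Set α} (hS : S.Finite) (f : α → ℕ) (K : ℕ)
    (hf : ∀ x ∈ S, f x < K) : S.ncard = ∑ k ∈ Finset.range K, {x | x ∈ S ∧ f x = k}.ncard := by
  classical
  rw [Set.ncard_eq_toFinset_card S hS, Finset.card_eq_sum_card_fiberwise (f := f)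
    (t := Finset.range K) fun x hx => by simpa using hf x (by simpa using hx)]
  refine Finset.sum_congr rfl fun k _ => ?_
  rw [← Set.ncard_coe_finset]
  congr 1
  ext x
  simp

/-- A pair of natural numbers is determined by its difference and its minimum. -/
def diffMinEquiv : ℕ × ℕ ≃ ℤ × ℕ where
  toFun x := ((x.1 : ℤ) - x.2, min x.1 x.2)
  invFun y := (y.1.toNat + y.2, (-y.1).toNat + y.2)
  left_inv x := by
    ext <;> simp only <;> omega
  right_inv y := by
    ext <;> simp only <;> omega

/-- Exponents of monomials in `z_j`, `\bar z_j` correspond to pairs of a vector of differences and a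
vector of minima. -/
def exponentEquiv (n : ℕ) : (Fin 2 × Fin n →₀ ℕ) ≃ (Fin n → ℤ) × (Fin n → ℕ) where
  toFun e := (fun j => (diffMinEquiv (e (0, j), e (1, j))).1,
    fun j => (diffMinEquiv (e (0, j), e (1, j))).2)
  invFun y := Finsupp.equivFunOnFinite.symm fun c =>
    if c.1 = 0 then (diffMinEquiv.symm (y.1 c.2, y.2 c.2)).1
      else (diffMinEquiv.symm (y.1 c.2, y.2 c.2)).2
  left_inv e := by
    ext ⟨a, j⟩
    obtain rfl | rfl : a = 0 ∨ a = 1 := by fin_cases a <;> simp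
    · simp
    · simp
  right_inv y := by
    ext j <;> simp

/-- The number of monomials of degree `r` in `n` variables. -/
def monomialCount (n r : ℕ) : ℕ := {m : Fin n → ℕ | ∑ j, m j = r}.ncard

theorem monomialCount_zero (n : ℕ) : monomialCount n 0 = 1 := by
  rw [monomialCount, Set.ncard_eq_one]
  refine ⟨0, ?_⟩
  ext m
  simp [Finset.sum_eq_zero_iff, funext_iff]

/-- Completing squares gives A² + m'² = B² + m² with A = 2r + m and B = j + m'. If m < m' then B ≥ A
+ 1, which is impossible as soon as 2A + 1 > m'² - m². -/
theorem eq_of_forall_mul_eq_mul {m m' : ℕ}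
    (h : ∀ r, ∃ j, 2 * r * (2 * r + 2 * m) = j * (j + 2 * m')) : m' ≤ m := by
  by_contra! hlt
  -- With r = m'² the gap 2A + 1 is at least 4m'² + 1.
  obtain ⟨j, hj⟩ := h (m' ^ 2)
  have h1 : (2 * m' ^ 2 + m) ^ 2 + m' ^ 2 = (j + m') ^ 2 + m ^ 2 := by
    linear_combination hj
  have h2 : 2 * m' ^ 2 + m < j + m' := by
    by_contra! hle
    nlinarith
  nlinarith

namespace LensParams

variable (P : LensParams)

theorem degree_eq_oneNorm_add (e : Fin 2 × Fin P.n →₀ ℕ) :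
    e.degree = oneNorm (exponentEquiv P.n e).1 + 2 * ∑ j, (exponentEquiv P.n e).2 j := by
  rw [Finsupp.degree_eq_sum, Fintype.sum_prod_type_right, oneNorm, Finset.mul_sum,
    ← Finset.sum_add_distrib]
  refine Finset.sum_congr rfl fun j _ => ?_
  simp only [Fin.sum_univ_two, exponentEquiv, diffMinEquiv, Equiv.coe_fn_mk]
  omega

theorem dvd_charge_iff (e : Fin 2 × Fin P.n →₀ ℕ) :
    (P.q : ℤ) ∣ P.charge e ↔ (exponentEquiv P.n e).1 ∈ P.congruenceLattice := by
  have h : P.charge e = -∑ j, (exponentEquiv P.n e).1 j * P.s j := by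
    rw [charge, Fintype.sum_prod_type_right, ← Finset.sum_neg_distrib]
    refine Finset.sum_congr rfl fun j _ => ?_
    simp [Fin.sum_univ_two, exponentEquiv, diffMinEquiv, coordAngle]
    ring
  rw [h, dvd_neg]
  exact (Int.modEq_zero_iff_dvd).symm

/-- The monomials are fibred by r, the sum of the minima; over each r the differences and the minima
vary independently. -/
theorem ncard_expSet_eq_sum (k : ℕ) :
    (P.expSet k 0).ncard =
      ∑ r ∈ Finset.range (k / 2 + 1), P.latticeCount (k - 2 * r) * monomialCount P.n r := by
  rw [ncard_eq_sum_ncard_fiber (P.finite_expSet k 0) (fun e => ∑ j, (exponentEquiv P.n e).2 j)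
    (k / 2 + 1)]
  · refine Finset.sum_congr rfl fun r hr => ?_
    have hr' : 2 * r ≤ k := by
      have := Finset.mem_range.1 hr
      omega
    rw [latticeCount, monomialCount, ← Set.ncard_prod,
      ← Set.ncard_image_of_injective _ (exponentEquiv P.n).injective]
    congr 1
    ext ⟨a, m⟩
    simp only [Set.mem_image, Set.mem_ofPred_eq, Set.mem_prod]
    constructor
    · rintro ⟨e, ⟨⟨h1, h2⟩, h3⟩, h4⟩
      rw [P.degree_eq_oneNorm_add, h3] at h1
      rw [P.dvd_charge_iff] at h2
      rw [h4] at h1 h2 h3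
      exact ⟨⟨h2, by simp only at h1; omega⟩, h3⟩
    · rintro ⟨⟨h1, h2⟩, h3⟩
      refine ⟨(exponentEquiv P.n).symm (a, m), ⟨⟨?_, ?_⟩, ?_⟩, Equiv.apply_symm_apply _ _⟩
      · rw [P.degree_eq_oneNorm_add, Equiv.apply_symm_apply]
        simp only [h2, h3]
        omega
      · rwa [P.dvd_charge_iff, Equiv.apply_symm_apply]
      · rwa [Equiv.apply_symm_apply]
  · intro e he
    have h1 := he.1
    rw [P.degree_eq_oneNorm_add] at h1
    omega

theorem ncard_expSet_two (k : ℕ) : (P.expSet (k + 2) 2).ncard = (P.expSet k 0).ncard := by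
  congr 1
  ext e
  simp [expSet]

theorem ncard_expSet_two_of_lt {k : ℕ} (hk : k < 2) : (P.expSet k 2).ncard = 0 := by
  have : P.expSet k 2 = ∅ := by
    ext e
    simp only [expSet, Set.mem_ofPred_eq, Set.mem_empty_iff_false, iff_false, not_and]
    omega
  rw [this, Set.ncard_empty]

/-- The even spherical eigenvalues are eigenvalues of every lens space. -/
theorem ncard_expSet_two_lt (r : ℕ) : (P.expSet (2 * r) 2).ncard < (P.expSet (2 * r) 0).ncard := by
  have hn := P.two_le_n
  let w : Fin P.n → (Fin 2 × Fin P.n →₀ ℕ) := fun j =>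
    Finsupp.single ((0 : Fin 2), j) 1 + Finsupp.single ((1 : Fin 2), j) 1
  let j₀ : Fin P.n := ⟨0, by omega⟩
  let j₁ : Fin P.n := ⟨1, by omega⟩
  rw [← Set.ncard_image_of_injective (P.expSet (2 * r) 2) (add_left_injective (w j₀))]
  refine Set.ncard_lt_ncard ?_ (P.finite_expSet _ _)
  rw [Set.ssubset_iff_of_subset]
  -- The invariant monomial (z_1 conj z_1)^r is not divisible by z_0 conj z_0; this requires two
  -- distinct planes, that is n ≥ 2.
  · refine ⟨r • w j₁, ⟨?_, ?_⟩, ?_⟩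
    · simp [w]
      omega
    · have h : ∀ t : ℕ, P.charge (t • w j₁) = 0 := fun t => by
        induction t with
        | zero => simp [charge]
        | succ t ih => rw [succ_nsmul, charge_add, ih, charge_single_add_single, add_zero]
      rw [h]
      exact dvd_zero _
    · rintro ⟨e, -, he⟩
      have h := DFunLike.congr_fun he ((0 : Fin 2), j₀)
      simp [w, j₀, j₁] at h
  · rintro _ ⟨e, he, rfl⟩
    exact (P.add_single_mem_expSet j₀).2 he

/-! ### Comparison of two lens spaces. -/

variable {P} {P' : LensParams}

/-- Each λ_{2r} of P has positive multiplicity, so it must be one of the spherical eigenvalues for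
P'. -/
theorem le_of_isospectral (h : P.Isospectral P') : P'.n - 1 ≤ P.n - 1 := by
  have hn := P.two_le_n
  have hn' := P'.two_le_n
  refine eq_of_forall_mul_eq_mul fun r => ?_
  by_contra! hne
  have h0 := P'.rank_eigenspace_eq_zero (μ := sphericalEigenvalue P.n (2 * r)) fun j hj => by
    rw [sphericalEigenvalue_eq_natCast (by omega), sphericalEigenvalue_eq_natCast (by omega),
      Nat.cast_inj] at hj
    exact hne j hj
  have h1 := P.finrank_eigenspace_add (2 * r)
  have h2 := P.ncard_expSet_two_lt r
  rw [← h] at h0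
  rw [Module.finrank, h0, map_zero] at h1
  omega

theorem ncard_expSet_eq_of_isospectral (h : P.Isospectral P') (hn : P.n = P'.n) (k : ℕ) :
    (P.expSet k 0).ncard = (P'.expSet k 0).ncard := by
  induction k using Nat.strong_induction_on with
  | _ k ih =>
    rw [← P.finrank_eigenspace_add, ← P'.finrank_eigenspace_add, Module.finrank, Module.finrank,
      h, congrArg (sphericalEigenvalue · k) hn]
    congr 1
    obtain hk | ⟨l, rfl⟩ : k < 2 ∨ ∃ l, k = l + 2 := by
      by_cases hk : k < 2
      · exact Or.inl hk
      · exact Or.inr ⟨k - 2, by omega⟩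
    · rw [P.ncard_expSet_two_of_lt hk, P'.ncard_expSet_two_of_lt hk]
    · rw [ncard_expSet_two, ncard_expSet_two, ih l (by omega)]

/-- The system is triangular in steps of 2, and the r = 0 term has coefficient `monomialCount n 0`,
which is 1. -/
theorem latticeCount_eq_of_ncard_expSet_eq (hn : P.n = P'.n)
    (h : ∀ k, (P.expSet k 0).ncard = (P'.expSet k 0).ncard) (k : ℕ) :
    P.latticeCount k = P'.latticeCount k := by
  induction k using Nat.strong_induction_on with
  | _ k ih =>
    have hk := h k
    rw [ncard_expSet_eq_sum, ncard_expSet_eq_sum, Finset.sum_range_succ', Finset.sum_range_succ',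
      hn] at hk
    have hs : ∑ r ∈ Finset.range (k / 2), P.latticeCount (k - 2 * (r + 1)) *
          monomialCount P'.n (r + 1) =
        ∑ r ∈ Finset.range (k / 2), P'.latticeCount (k - 2 * (r + 1)) *
          monomialCount P'.n (r + 1) := by
      refine Finset.sum_congr rfl fun r hr => ?_
      have := Finset.mem_range.1 hr
      rw [ih _ (by omega)]
    rw [hs] at hk
    simpa [monomialCount_zero] using hk

theorem isospectral_of_latticeCount_eq (hn : P.n = P'.n)
    (h : ∀ k, P.latticeCount k = P'.latticeCount k) : P.Isospectral P' := by
  have hc : ∀ k, (P.expSet k 0).ncard = (P'.expSet k 0).ncard := fun k => by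
    rw [ncard_expSet_eq_sum, ncard_expSet_eq_sum]
    simp only [h, hn]
  have hc2 : ∀ k, (P.expSet k 2).ncard = (P'.expSet k 2).ncard := fun k => by
    obtain hk | ⟨l, rfl⟩ : k < 2 ∨ ∃ l, k = l + 2 := by
      by_cases hk : k < 2
      · exact Or.inl hk
      · exact Or.inr ⟨k - 2, by omega⟩
    · rw [P.ncard_expSet_two_of_lt hk, P'.ncard_expSet_two_of_lt hk]
    · rw [ncard_expSet_two, ncard_expSet_two, hc]
  intro μ
  by_cases hμ : ∃ k, μ = sphericalEigenvalue P.n k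
  · obtain ⟨k, rfl⟩ := hμ
    have h1 := P.finrank_eigenspace_add k
    have h2 := P'.finrank_eigenspace_add k
    rw [← congrArg (sphericalEigenvalue · k) hn] at h2
    have hfin : FiniteDimensional ℂ (P'.eigenspace (sphericalEigenvalue P.n k)) := by
      rw [hn]
      infer_instance
    rw [← Module.finrank_eq_rank, ← Module.finrank_eq_rank]
    have := hc k
    have := hc2 k
    congr 1
    omega
  · push Not at hμ
    rw [P.rank_eigenspace_eq_zero hμ, P'.rank_eigenspace_eq_zero (by rwa [← hn])]

/-! ### Growth of the lattice counts determines n. -/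

theorem finite_oneNorm_le {n : ℕ} (K : ℕ) : {a : Fin n → ℤ | oneNorm a ≤ K}.Finite := by
  refine ((Set.finite_Iic K).biUnion fun k _ => finite_oneNorm_eq k).subset fun a ha => ?_
  simp only [Set.mem_iUnion]
  exact ⟨oneNorm a, ha, rfl⟩

theorem sum_latticeCount (P : LensParams) (K : ℕ) :
    ∑ k ∈ Finset.range (K + 1), P.latticeCount k =
      {a : Fin P.n → ℤ | a ∈ P.congruenceLattice ∧ oneNorm a ≤ K}.ncard := by
  rw [ncard_eq_sum_ncard_fiber ((finite_oneNorm_le K).subset fun a ha => ha.2) oneNorm (K + 1)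
    fun a ha => Nat.lt_succ_of_le ha.2]
  refine Finset.sum_congr rfl fun k hk => ?_
  rw [latticeCount]
  congr 1
  ext a
  have := Finset.mem_range.1 hk
  simp only [Set.mem_ofPred_eq]
  constructor
  · rintro ⟨h1, h2⟩
    exact ⟨⟨h1, by omega⟩, h2⟩
  · rintro ⟨⟨h1, -⟩, h2⟩
    exact ⟨h1, h2⟩

theorem sum_latticeCount_le (P : LensParams) (K : ℕ) :
    ∑ k ∈ Finset.range (K + 1), P.latticeCount k ≤ (2 * K + 1) ^ P.n := by
  rw [sum_latticeCount]
  have h : {a : Fin P.n → ℤ | a ∈ P.congruenceLattice ∧ oneNorm a ≤ K} ⊆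
      (Fintype.piFinset fun _ : Fin P.n => Finset.Icc (-(K : ℤ)) K : Finset (Fin P.n → ℤ)) := by
    rintro a ⟨-, ha⟩
    simp only [Finset.mem_coe, Fintype.mem_piFinset, Finset.mem_Icc]
    intro j
    have h : (a j).natAbs ≤ oneNorm a :=
      Finset.single_le_sum (f := fun j => (a j).natAbs) (fun _ _ => Nat.zero_le _)
        (Finset.mem_univ j)
    omega
  refine (Set.ncard_le_ncard h (Finset.finite_toSet _)).trans ?_
  rw [Set.ncard_coe_finset, Fintype.card_piFinset]
  simp only [Int.card_Icc, Finset.prod_const, Finset.card_univ, Fintype.card_fin]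
  refine Nat.pow_le_pow_left ?_ _
  omega

/-- The lattice contains qℤⁿ, and the points of q{0, …, R}ⁿ have one-norm at most nqR. -/
theorem le_sum_latticeCount (P : LensParams) (R : ℕ) :
    (R + 1) ^ P.n ≤ ∑ k ∈ Finset.range (P.n * (P.q * R) + 1), P.latticeCount k := by
  rw [sum_latticeCount]
  let φ : (Fin P.n → Fin (R + 1)) → (Fin P.n → ℤ) := fun v j => P.q * (v j : ℕ)
  have hφ : Function.Injective φ := fun v w h => by
    funext j
    have := congrFun h j
    have hq := P.q_pos.ne'
    simp only [φ] at this
    exact Fin.ext (by simpa [hq] using this)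
  have h1 : (R + 1) ^ P.n = (φ '' Set.univ).ncard := by
    rw [Set.ncard_image_of_injective _ hφ, Set.ncard_univ, Nat.card_eq_fintype_card]
    simp
  rw [h1]
  refine Set.ncard_le_ncard ?_ ((finite_oneNorm_le _).subset fun a ha => ha.2)
  rintro _ ⟨v, -, rfl⟩
  constructor
  · change _ ≡ 0 [ZMOD P.q]
    rw [Int.modEq_zero_iff_dvd]
    exact Finset.dvd_sum fun j _ => (Dvd.intro _ rfl : (P.q : ℤ) ∣ φ v j).mul_right _
  · have h2 : ∀ j, (φ v j).natAbs ≤ P.q * R := fun j => by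
      simp only [φ, Int.natAbs_mul, Int.natAbs_natCast]
      exact Nat.mul_le_mul_left _ (Nat.lt_succ_iff.1 (v j).2)
    refine (Finset.sum_le_sum fun j _ => h2 j).trans ?_
    simp

/-- The two growth bounds give (R + 1)^n ≤ C (R + 1)^{n'} with C independent of R; if n > n' then R
+ 1 ≤ C for every R, which fails at R = C. -/
theorem n_le_of_latticeCount_eq (h : ∀ k, P.latticeCount k = P'.latticeCount k) :
    P.n ≤ P'.n := by
  by_contra! hlt
  have key : ∀ R : ℕ, R + 1 ≤ (2 * (P.n * P.q) + 1) ^ P'.n := fun R => by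
    have h1 := P.le_sum_latticeCount R
    simp only [h] at h1
    have h2 := h1.trans (P'.sum_latticeCount_le _)
    have h3 : 2 * (P.n * (P.q * R)) + 1 ≤ (2 * (P.n * P.q) + 1) * (R + 1) := by
      nlinarith [Nat.zero_le (P.n * P.q)]
    have h4 := h2.trans (Nat.pow_le_pow_left h3 P'.n)
    have h5 : (R + 1) ^ (P'.n + 1) ≤ (R + 1) ^ P.n := Nat.pow_le_pow_right (by omega) hlt
    rw [mul_pow] at h4
    rw [pow_succ'] at h5
    exact Nat.le_of_mul_le_mul_right (h5.trans h4) (by positivity)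
  have := key ((2 * (P.n * P.q) + 1) ^ P'.n)
  omega

theorem theta_eq_iff : P.theta = P'.theta ↔ ∀ k, P.latticeCount k = P'.latticeCount k := by
  simp only [theta, PowerSeries.ext_iff, PowerSeries.coeff_mk, Nat.cast_inj]

end LensParams

end LensSpectra

end

theorem mainTheorem2 (P P' : LensSpectra.LensParams) :
    P.Isospectral P' ↔ P.theta = P'.theta := by
  rw [LensSpectra.LensParams.theta_eq_iff]
  constructor
  · intro h
    have h1 := LensSpectra.LensParams.le_of_isospectral h
    have h2 := LensSpectra.LensParams.le_of_isospectral fun μ => (h μ).symm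
    have hP := P.two_le_n
    have hP' := P'.two_le_n
    have hn : P.n = P'.n := by omega
    exact LensSpectra.LensParams.latticeCount_eq_of_ncard_expSet_eq hn
      (LensSpectra.LensParams.ncard_expSet_eq_of_isospectral h hn)
  · intro h
    exact LensSpectra.LensParams.isospectral_of_latticeCount_eq
      (le_antisymm (LensSpectra.LensParams.n_le_of_latticeCount_eq h)
        (LensSpectra.LensParams.n_le_of_latticeCount_eq fun k => (h k).symm)) h
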